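/- **Proposition 3.1.** Let $d\ge 1$ and let $X=(X_t)_{t\ge 0}$ be a pure-jump isotropic Lévy process in $\mathbb{R}^d$ (i.e. a Lévy process without Gaussian part whose one-dimensional laws are invariant under linear isometries) with characteristic exponent $\psi(\xi)=\psi(|\xi|)$, that is, $E\,e^{i\langle\xi, X_t\rangle}=e^{-t\psi(|\xi|)}$ for all $t\ge 0$, $\xi\in\mathbb{R}^d$. Assume that the Lévy measure of $X$ has a density $\nu(x)=\nu(|x|)$ with $\nu(r)\ge 0$ nonincreasing on $(0,\infty)$, and that $$\lim_{\rho\to\infty}\frac{\psi(\rho)}{\log\rho}=\infty .$$ Then, for each $t>0$, $X_t$ has a radial density $p_t(x)=p_t(|x|)$ with $p_t$ continuous on $(0,\infty)$ (which determines $p_t(r)$ for $r>0$), and there exists a Lévy process $X^{(d+2)}$ in $\mathbb{R}^{d+2}$ with characteristic exponent $\psi^{(d+2)}(\xi)=\psi(|\xi|)$, $\xi\in\mathbb{R}^{d+2}$, such that for each $t>0$, $X^{(d+2)}_t$ has a radial density $p_t^{(d+2)}(x)=p_t^{(d+2)}(|x|)$, continuous on $\mathbb{R}^{d+2}\setminus\{0\}$;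 moreover, $p_t$ is differentiable on $(0,\infty)$ and $$p_t^{(d+2)}(r)=\frac{-1}{2\pi r}\,\frac{d}{dr}p_t(r),\qquad t>0,\ r>0 .$$ -/

import Mathlib

open MeasureTheory ProbabilityTheory Set Filter Topology
open scoped NNReal ENNReal

/-- A function of time is càdlàg: right-continuous with left limits (at `t = 0` the second
condition is empty). -/
def IsCadlagPath {E : Type*} [TopologicalSpace E] (f : ℝ≥0 → E) : Prop :=
  ∀ t : ℝ≥0, ContinuousWithinAt f (Ici t) t ∧ ∃ l : E, Tendsto f (𝓝[<] t) (𝓝 l)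

/-- `X` is a Lévy process under `P`: it starts at `0`, has independent and stationary increments
and almost surely càdlàg paths. (Stochastic continuity follows from right-continuity at `0` and
stationarity of the increments.) -/
structure IsLevyProcess {Ω E : Type*} [MeasurableSpace Ω] [NormedAddCommGroup E]
    [MeasurableSpace E] (P : Measure Ω) (X : ℝ≥0 → Ω → E) : Prop where
  measurable : ∀ t, Measurable (X t)
  start_zero : ∀ᵐ ω ∂P, X 0 ω = 0
  indep_increments : HasIndepIncrements X P
  stationary_increments : ∀ s h : ℝ≥0,
    P.map (fun ω => X (s + h) ω - X s ω) = P.map (fun ω => X h ω - X 0 ω)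
  cadlag : ∀ᵐ ω ∂P, IsCadlagPath (fun t => X t ω)

section

variable {Ω E : Type*} [MeasurableSpace Ω] [NormedAddCommGroup E] [InnerProductSpace ℝ E]
  [MeasurableSpace E]

/-- `ψ` is the (real-valued) characteristic exponent of `X`:
`𝔼 exp (i ⟨ξ, X t⟩) = exp (-t ψ ξ)` for all `t ≥ 0` and all `ξ`. -/
def HasCharExponent (P : Measure Ω) (X : ℝ≥0 → Ω → E) (ψ : E → ℝ) : Prop :=
  ∀ (t : ℝ≥0) (ξ : E),
    charFun (P.map (X t)) ξ = Complex.exp (((-((t : ℝ) * ψ ξ) : ℝ) : ℂ))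

/-- The laws of `X` are invariant under all linear isometries (rotations and reflections). -/
def IsIsotropicProcess (P : Measure Ω) (X : ℝ≥0 → Ω → E) : Prop :=
  ∀ (U : E ≃ₗᵢ[ℝ] E) (t : ℝ≥0), P.map (fun ω => U (X t ω)) = P.map (X t)

/-- A Lévy measure: no mass at `0` and `∫ (|x|² ∧ 1) N(dx) < ∞`. -/
structure IsLevyMeasure (N : Measure E) : Prop where
  zero : N {0} = 0
  lintegral_lt_top : ∫⁻ x, ENNReal.ofReal (min (‖x‖ ^ 2) 1) ∂N < ∞

/-- `X` has the generating triplet `(A, N, b)` (Gaussian covariance, Lévy measure, drift):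
`A` is symmetric and positive semidefinite, `N` is a Lévy measure, and the Lévy–Khintchine formula
with truncation to the closed unit ball holds. -/
structure HasLevyTriplet (P : Measure Ω) (X : ℝ≥0 → Ω → E) (A : E →L[ℝ] E) (N : Measure E)
    (b : E) : Prop where
  gaussian : A.IsPositive
  levyMeasure : IsLevyMeasure N
  charFun_eq : ∀ (t : ℝ≥0) (ξ : E), charFun (P.map (X t)) ξ =
    Complex.exp ((t : ℂ) * (-(1 / 2 : ℂ) * ((inner ℝ (A ξ) ξ : ℝ) : ℂ)
      + ((inner ℝ b ξ : ℝ) : ℂ) * Complex.I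
      + ∫ x, (Complex.exp (((inner ℝ x ξ : ℝ) : ℂ) * Complex.I) - 1
          - (Metric.closedBall (0 : E) 1).indicator
              (fun y => ((inner ℝ y ξ : ℝ) : ℂ) * Complex.I) x) ∂N))

/-- `X` is pure-jump with Lévy measure `N`: its generating triplet has no Gaussian part. -/
def IsPureJumpWithLevyMeasure (P : Measure Ω) (X : ℝ≥0 → Ω → E) (N : Measure E) : Prop :=
  ∃ b : E, HasLevyTriplet P X 0 N b

end

/-- The measure `f(|x|) dx` on `ℝᵈ` with the radial profile `f` (the value `f 0` is irrelevant
for `d ≥ 1`). -/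
noncomputable def radialMeasure (d : ℕ) (f : ℝ → ℝ) : Measure (EuclideanSpace ℝ (Fin d)) :=
  volume.withDensity (fun x => ENNReal.ofReal (f ‖x‖))

/-- `p` is the radial profile of the transition density of `X`: for each `t > 0` the law of `X t`
is `p t (|x|) dx`, where `p t` is nonnegative and continuous on `(0, ∞)`. Continuity singles out
the values `p t r`, `r > 0`, among the almost everywhere equal versions of the density. -/
def IsRadialTransitionDensity {Ω : Type*} [MeasurableSpace Ω] {d : ℕ} (P : Measure Ω)
    (X : ℝ≥0 → Ω → EuclideanSpace ℝ (Fin d)) (p : ℝ≥0 → ℝ → ℝ) : Prop :=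
  ∀ t : ℝ≥0, 0 < t →
    (∀ r : ℝ, 0 < r → 0 ≤ p t r) ∧ ContinuousOn (p t) (Ioi 0) ∧
      P.map (X t) = radialMeasure d (p t)

/-!
The law of `X t` is the image of the law of the `(d + 2)`-dimensional process under the orthogonal
projection `π : ℝᵈ × ℂ → ℝᵈ`, because both have the characteristic function `exp (-t ψ(|ξ|))` on
`ℝᵈ`. If the latter law has the continuous radial density `q(|x|)`, integrating over the planar
fibres of `π` in polar coordinates gives the density
`p(r) = 2 π ∫_0^∞ q(√(r² + s²)) s ds = 2 π ∫_r^∞ v q(v) dv` of `X t` (`map_fst_withDensity_norm`),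
and the assertion `p' = -2 π r q` is the fundamental theorem of calculus
(`exists_hasDerivAt_map_fst_eq_withDensity`). The density `q` exists, and is continuous even at the
origin, because the growth of `ψ` makes the characteristic function integrable
(`integrable_charFun_of_tendsto_div_log`, `exists_continuous_radial_density`). Any other version of
the density of `X t` that is continuous away from the origin agrees with `p`
(`eqOn_of_withDensity_norm_eq`).

The substance is that `ψ(|ξ|)` is again the exponent of a Lévy process on `ℝᵈ⁺²`. Here the
monotonicity of `ν` enters: by the layer-cake formula the Lévy measure `ν(|x|) dx` is a mixture of
uniform measures on balls, and by Archimedes' hat-box theorem (`lintegral_sphereMeasure_fst`) the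
uniform measure on a ball is the projection of the uniform measure on the sphere of the same radius
in `ℝᵈ × ℂ`. So `ν(|x|) dx` is the projection of a rotation invariant measure `N'`
(`exists_measure_map_fst_eq_withDensity`). All one-dimensional marginals of `N'` agree with those of
`ν(|x|) dx`, so that `N'` is a Lévy measure and `∫ (1 - cos ⟪x, ξ⟫) N'(dx) = ψ(|ξ|)`.

A Lévy process with a symmetric Lévy measure `N` is constructed by hand
(`exists_isLevyProcess_hasCharExponent`). The space of jumps is cut into countably many cells of
finite intensity, each of which carries an independent compound Poisson process. Lévy's maximal
inequality bounds the paths of the processes of small jumps uniformly on compact time intervals, so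
that the series of paths converges uniformly and its sum is càdlàg. Symmetry makes compensation
unnecessary, and the joint law of the increments passes to the limit in the form of
`HasIncrementExponent`.
-/

/-! ### Lévy's maximal inequality -/

/-- **Lévy's maximal inequality** for independent symmetric summands. Split according to the first
time `k` at which the partial sum has norm at least `ε`; reflecting the summands after step `k`
preserves the law and the event, and the original and the reflected final sums cannot both have norm
less than `ε`, because they add up to twice the `k`-th partial sum. -/
theorem measure_exists_le_norm_sum_le {Ω E : Type*} [MeasurableSpace Ω] [NormedAddCommGroup E]
    [NormedSpace ℝ E] [MeasurableSpace E] [BorelSpace E] [SecondCountableTopology E]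
    {P : Measure Ω} [IsProbabilityMeasure P] {D : ℕ → Ω → E} (hD : ∀ i, Measurable (D i))
    (hindep : iIndepFun D P) (hsymm : ∀ i, P.map (fun ω => -D i ω) = P.map (D i))
    (ε : ℝ) (n : ℕ) :
    P {ω | ∃ k ≤ n, ε ≤ ‖∑ i ∈ Finset.range k, D i ω‖} ≤
      2 * P {ω | ε ≤ ‖∑ i ∈ Finset.range n, D i ω‖} := by
  classical
  -- `A k`: the partial sums reach norm `ε` for the first time at step `k`
  set A : ℕ → Set (ℕ → E) := fun k => {x | ε ≤ ‖∑ i ∈ Finset.range k, x i‖ ∧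
    ∀ j < k, ‖∑ i ∈ Finset.range j, x i‖ < ε} with hA
  set B : Set (ℕ → E) := {x | ε ≤ ‖∑ i ∈ Finset.range n, x i‖} with hB
  set T : Ω → ℕ → E := fun ω i => D i ω with hT
  have hTm : Measurable T := measurable_pi_lambda _ hD
  have hsm : ∀ k, Measurable fun x : ℕ → E => ‖∑ i ∈ Finset.range k, x i‖ := fun k => by
    fun_prop
  have hBm : MeasurableSet B := measurableSet_le measurable_const (hsm n)
  have hAm : ∀ k, MeasurableSet (A k) := fun k => by
    have : A k = {x | ε ≤ ‖∑ i ∈ Finset.range k, x i‖} ∩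
        ⋂ j ∈ Finset.range k, {x | ‖∑ i ∈ Finset.range j, x i‖ < ε} := by
      ext x; simp [hA]
    rw [this]
    exact (measurableSet_le measurable_const (hsm k)).inter
      (Finset.measurableSet_biInter _ fun j _ => measurableSet_lt (hsm j) measurable_const)
  -- the reflection of the path after step `k`
  let R : ℕ → (ℕ → E) → ℕ → E := fun k x i => if i < k then x i else -x i
  have hRm : ∀ k, Measurable (R k) := fun k => measurable_pi_lambda _ fun i => by
    by_cases h : i < k <;> simp only [R, h, if_true, if_false] <;> fun_prop
  have hlaw : ∀ k, (P.map T).map (R k) = P.map T := fun k => by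
    let φ : ℕ → E → E := fun i y => if i < k then y else -y
    have hφ : ∀ i, Measurable (φ i) := fun i => by
      by_cases h : i < k <;> simp only [φ, h, if_true, if_false] <;> fun_prop
    have h1 := hindep.map_fun_eq_infinitePi_map hD
    have h2 := (hindep.comp φ hφ).map_fun_eq_infinitePi_map (fun i => (hφ i).comp (hD i))
    rw [Measure.map_map (hRm k) hTm]
    have : (R k ∘ T) = fun ω i => (φ i ∘ D i) ω := by
      ext ω i; simp [R, T, φ]
    rw [this, h2, h1]
    congr 1
    ext1 i
    by_cases h : i < k
    · have : φ i ∘ D i = D i := by ext ω; simp [φ, h]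
      rw [this]
    · have : φ i ∘ D i = fun ω => -D i ω := by ext ω; simp [φ, h]
      rw [this, hsymm]
  set μ := P.map T with hμ
  have hRsum : ∀ k, k ≤ n → ∀ x : ℕ → E, ∑ i ∈ Finset.range n, x i +
      ∑ i ∈ Finset.range n, R k x i = (2 : ℕ) • ∑ i ∈ Finset.range k, x i := by
    intro k hk x
    rw [← Finset.sum_add_distrib, ← Finset.sum_range_add_sum_Ico _ hk, ← add_zero (2 • _),
      Finset.smul_sum]
    congr 1
    · refine Finset.sum_congr rfl fun i hi => ?_
      simp [R, Finset.mem_range.1 hi, two_nsmul]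
    · refine Finset.sum_eq_zero fun i hi => ?_
      simp [R, (Finset.mem_Ico.1 hi).1.not_gt]
  have hRA : ∀ k x, R k x ∈ A k ↔ x ∈ A k := by
    intro k x
    have : ∀ j ≤ k, ∑ i ∈ Finset.range j, R k x i = ∑ i ∈ Finset.range j, x i := fun j hj =>
      Finset.sum_congr rfl fun i hi => by simp [R, (Finset.mem_range.1 hi).trans_le hj]
    simp only [hA, mem_ofPred_eq, this k le_rfl]
    refine and_congr_right fun _ => forall₂_congr fun j hj => by rw [this j hj.le]
  have hstep : ∀ k ≤ n, μ (A k) ≤ 2 * μ (A k ∩ B) := by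
    intro k hk
    have hsub : A k ⊆ (A k ∩ B) ∪ R k ⁻¹' (A k ∩ B) := by
      intro x hx
      by_contra hcon
      simp only [mem_union, mem_inter_iff, mem_preimage, hRA, hx, true_and, not_or, hB,
        mem_ofPred_eq, not_le] at hcon
      have h := norm_add_le (∑ i ∈ Finset.range n, x i) (∑ i ∈ Finset.range n, R k x i)
      rw [hRsum k hk, two_nsmul, ← two_smul ℝ, norm_smul] at h
      have := hx.1
      norm_num at h
      linarith
    calc μ (A k) ≤ μ (A k ∩ B) + μ (R k ⁻¹' (A k ∩ B)) :=
          (measure_mono hsub).trans (measure_union_le _ _)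
      _ = 2 * μ (A k ∩ B) := by
          rw [← Measure.map_apply (hRm k) ((hAm k).inter hBm), hlaw, two_mul]
  have hdisj : Pairwise (Function.onFun Disjoint fun k => A k ∩ B) := by
    intro k l hkl
    refine Set.disjoint_left.2 fun x hx hx' => ?_
    rcases lt_or_gt_of_ne hkl with h | h
    · exact (hx'.1.2 k h).not_ge hx.1.1
    · exact (hx.1.2 l h).not_ge hx'.1.1
  have hcover : {ω | ∃ k ≤ n, ε ≤ ‖∑ i ∈ Finset.range k, D i ω‖} ⊆
      T ⁻¹' ⋃ k ∈ Finset.range (n + 1), A k := by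
    rintro ω hω
    have hk := Nat.find_spec hω
    simp only [mem_preimage, mem_iUnion]
    refine ⟨Nat.find hω, Finset.mem_range.2 (by omega), hk.2, fun j hj => ?_⟩
    have := Nat.find_min hω hj
    simp only [not_and, not_le] at this
    exact this (hj.le.trans hk.1)
  calc P {ω | ∃ k ≤ n, ε ≤ ‖∑ i ∈ Finset.range k, D i ω‖}
      ≤ μ (⋃ k ∈ Finset.range (n + 1), A k) := by
        rw [hμ, Measure.map_apply hTm (Finset.measurableSet_biUnion _ fun k _ => hAm k)]
        exact measure_mono hcover
    _ ≤ ∑ k ∈ Finset.range (n + 1), μ (A k) := measure_biUnion_finset_le _ _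
    _ ≤ ∑ k ∈ Finset.range (n + 1), 2 * μ (A k ∩ B) :=
        Finset.sum_le_sum fun k hk => hstep k (by simpa [Nat.lt_succ_iff] using hk)
    _ = 2 * μ (⋃ k ∈ Finset.range (n + 1), A k ∩ B) := by
        rw [← Finset.mul_sum, measure_biUnion_finset (fun k _ l _ h => hdisj h)
          fun k _ => (hAm k).inter hBm]
    _ ≤ 2 * μ B := by
        gcongr
        exact iUnion₂_subset fun k _ => inter_subset_right
    _ = 2 * P {ω | ε ≤ ‖∑ i ∈ Finset.range n, D i ω‖} := by
        rw [hμ, Measure.map_apply hTm hBm]; rfl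

/-! ### Characteristic functions of increments and Poisson point processes -/

/-- The increments of `Y` over consecutive intervals `[t i, t (i + 1)]` have joint characteristic
function `ξ ↦ ∏ i, exp (c (t i) (t (i + 1)) (ξ i))`, for a real-valued `c`. This packages
independence and symmetry of the increments together with their laws in a form that is stable under
independent sums and under pointwise limits. -/
def HasIncrementExponent {Ω E : Type*} [MeasurableSpace Ω] [NormedAddCommGroup E]
    [InnerProductSpace ℝ E] (P : Measure Ω) (Y : ℝ≥0 → Ω → E) (c : ℝ≥0 → ℝ≥0 → E → ℝ) : Prop :=
  ∀ (n : ℕ) (t : Fin (n + 1) → ℝ≥0), Monotone t → ∀ ξ : Fin n → E,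
    ∫ ω, Complex.exp (((∑ i, inner ℝ (Y (t i.succ) ω - Y (t i.castSucc) ω) (ξ i) : ℝ) : ℂ) *
      Complex.I) ∂P = Complex.exp ((∑ i, c (t i.castSucc) (t i.succ) (ξ i) : ℝ) : ℂ)

namespace HasIncrementExponent

variable {Ω E : Type*} [MeasurableSpace Ω] [NormedAddCommGroup E] [InnerProductSpace ℝ E]
  [MeasurableSpace E] [BorelSpace E] [SecondCountableTopology E]
  {P : Measure Ω} {Y : ℝ≥0 → Ω → E} {c : ℝ≥0 → ℝ≥0 → E → ℝ}

theorem charFun_sub (h : HasIncrementExponent P Y c) (hY : ∀ t, Measurable (Y t)) {s t : ℝ≥0}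
    (hst : s ≤ t) (ξ : E) :
    charFun (P.map fun ω => Y t ω - Y s ω) ξ = Complex.exp (c s t ξ : ℝ) := by
  have := h 1 ![s, t] (by
    intro i j hij
    fin_cases i <;> fin_cases j <;> simp_all) (fun _ => ξ)
  rw [charFun_apply, integral_map (by fun_prop) (by fun_prop)]
  simpa using this

theorem map_neg_sub [CompleteSpace E] [IsProbabilityMeasure P]
    (h : HasIncrementExponent P Y c) (hY : ∀ t, Measurable (Y t)) {s t : ℝ≥0}
    (hst : s ≤ t) :
    P.map (fun ω => -(Y t ω - Y s ω)) = P.map fun ω => Y t ω - Y s ω := by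
  have hm : Measurable fun ω => Y t ω - Y s ω := (hY t).sub (hY s)
  have := Measure.isProbabilityMeasure_map (μ := P) hm.aemeasurable
  have : IsProbabilityMeasure (P.map fun ω => -(Y t ω - Y s ω)) :=
    Measure.isProbabilityMeasure_map hm.neg.aemeasurable
  refine Measure.ext_of_charFun (funext fun ξ => ?_)
  have h1 : charFun (P.map fun ω => -(Y t ω - Y s ω)) ξ =
      charFun (P.map fun ω => Y t ω - Y s ω) (-ξ) := by
    rw [charFun_apply, charFun_apply, integral_map (by fun_prop) (by fun_prop),
      integral_map (by fun_prop) (by fun_prop)]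
    simp_rw [inner_neg_left, inner_neg_right]
  rw [h1, charFun_neg, h.charFun_sub hY hst, ← Complex.exp_conj, Complex.conj_ofReal]

theorem hasIndepIncrements [CompleteSpace E] [IsProbabilityMeasure P]
    (h : HasIncrementExponent P Y c) (hY : ∀ t, Measurable (Y t)) :
    HasIndepIncrements Y P := by
  intro n t ht
  rw [iIndepFun_iff_charFun_pi (by fun_prop)]
  intro ξ
  rw [charFun_apply, integral_map (by fun_prop) (by fun_prop)]
  simp_rw [h.charFun_sub hY (ht Fin.castSucc_lt_succ.le), ← Complex.exp_sum, PiLp.inner_apply]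
  simpa using h n t ht (fun i => ξ i)

theorem of_tendsto [IsProbabilityMeasure P] {Z : ℕ → ℝ≥0 → Ω → E} {b : ℕ → ℝ≥0 → ℝ≥0 → E → ℝ}
    (h : ∀ k, HasIncrementExponent P (Z k) (b k)) (hZ : ∀ k t, Measurable (Z k t))
    (hlim : ∀ᵐ ω ∂P, ∀ t, Tendsto (fun k => Z k t ω) atTop (𝓝 (Y t ω)))
    (hb : ∀ s t ξ, s ≤ t → Tendsto (fun k => b k s t ξ) atTop (𝓝 (c s t ξ))) :
    HasIncrementExponent P Y c := by
  intro n t ht ξ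
  refine tendsto_nhds_unique ?_ (?_ : Tendsto (fun k => Complex.exp
    ((∑ i, b k (t i.castSucc) (t i.succ) (ξ i) : ℝ) : ℂ)) atTop _)
  rotate_left
  · refine (Complex.continuous_exp.tendsto _).comp
      ((Complex.continuous_ofReal.tendsto _).comp (tendsto_finsetSum _ fun i _ => ?_))
    exact hb _ _ _ (ht Fin.castSucc_lt_succ.le)
  · simp_rw [← fun k => h k n t ht ξ]
    refine tendsto_integral_of_dominated_convergence (fun _ => 1) (fun k => ?_)
      (integrable_const _) (fun k => ?_) ?_
    · fun_prop
    · exact Eventually.of_forall fun ω => by rw [Complex.norm_exp_ofReal_mul_I]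
    · filter_upwards [hlim] with ω hω
      refine (Complex.continuous_exp.tendsto _).comp (Tendsto.mul_const _
        ((Complex.continuous_ofReal.tendsto _).comp (tendsto_finsetSum _ fun i _ => ?_)))
      exact ((hω _).sub (hω _)).inner tendsto_const_nhds

end HasIncrementExponent

/-- The law of a Poisson point process with finite intensity measure `Λ`, encoded as a Poisson
number `ω.1` of points together with an infinite i.i.d. sequence `ω.2` of locations with law
`Λ / Λ(univ)`, of which only the first `ω.1` are points of the process. -/
noncomputable def poissonPointLaw {α : Type*} [MeasurableSpace α] [Nonempty α]
    (Λ : FiniteMeasure α) : Measure (ℕ × (ℕ → α)) :=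
  (poissonMeasure Λ.mass).prod (Measure.infinitePi fun _ => (Λ.normalize : Measure α))

instance {α : Type*} [MeasurableSpace α] [Nonempty α] (Λ : FiniteMeasure α) :
    IsProbabilityMeasure (poissonPointLaw Λ) := by
  unfold poissonPointLaw; infer_instance

theorem measurable_sum_range_fst {α β : Type*} [MeasurableSpace α] [AddCommMonoid β]
    [MeasurableSpace β] [MeasurableAdd₂ β] {g : α → β} (hg : Measurable g) :
    Measurable fun ω : ℕ × (ℕ → α) => ∑ j ∈ Finset.range ω.1, g (ω.2 j) :=
  measurable_from_prod_countable_right fun k => by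
    have : ∀ j : ℕ, Measurable fun z : ℕ → α => g (z j) := fun j =>
      hg.comp (measurable_pi_apply j)
    change Measurable fun z : ℕ → α => ∑ j ∈ Finset.range k, g (z j)
    fun_prop

theorem integral_cexp_sum_infinitePi {α : Type*} [MeasurableSpace α] (π : ℕ → Measure α)
    [∀ j, IsProbabilityMeasure (π j)] {g : ℕ → α → ℝ} (hg : ∀ j, Measurable (g j)) (k : ℕ) :
    ∫ z : ℕ → α, Complex.exp (((∑ j ∈ Finset.range k, g j (z j) : ℝ) : ℂ) * Complex.I)
      ∂(Measure.infinitePi π) =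
      ∏ j ∈ Finset.range k, ∫ x, Complex.exp ((g j x : ℂ) * Complex.I) ∂(π j) := by
  have hind : iIndepFun (fun (j : ℕ) (z : ℕ → α) => g j (z j)) (Measure.infinitePi π) :=
    iIndepFun_infinitePi (X := g) hg
  have hm : ∀ j : ℕ, Measurable fun z : ℕ → α => g j (z j) := fun j =>
    (hg j).comp (measurable_pi_apply j)
  have h := congrFun ((hind.restrict (Finset.range k)).charFun_map_fun_finsetSum_eq_prod
    fun j _ => (hm j).aemeasurable) 1
  rw [charFun_apply_real, integral_map (Finset.measurable_sum _ fun j _ => hm j).aemeasurable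
    (by fun_prop)] at h
  simp only [Complex.ofReal_one, one_mul] at h
  rw [h, Finset.prod_apply]
  refine Finset.prod_congr rfl fun j _ => ?_
  rw [charFun_apply_real, integral_map (hm j).aemeasurable (by fun_prop)]
  simp only [Complex.ofReal_one, one_mul]
  conv_rhs => rw [← Measure.infinitePi_map_eval π j]
  rw [integral_map (measurable_pi_apply j).aemeasurable]
  exact ((Complex.measurable_ofReal.comp (hg j)).mul_const _).cexp.aestronglyMeasurable

/-- Campbell's formula for the characteristic functional of a Poisson point process of finite
intensity. -/
theorem integral_cexp_poissonPointLaw {α : Type*} [MeasurableSpace α] [Nonempty α]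
    (Λ : FiniteMeasure α) {g : α → ℝ} (hg : Measurable g) :
    ∫ ω, Complex.exp (((∑ j ∈ Finset.range ω.1, g (ω.2 j) : ℝ) : ℂ) * Complex.I)
      ∂(poissonPointLaw Λ) =
      Complex.exp (∫ x, (Complex.exp ((g x : ℂ) * Complex.I) - 1) ∂(Λ : Measure α)) := by
  have hint : Integrable (fun x => Complex.exp ((g x : ℂ) * Complex.I))
      (Λ.normalize : Measure α) :=
    Integrable.of_bound (by fun_prop) 1 (Eventually.of_forall fun x => by
      rw [Complex.norm_exp_ofReal_mul_I])
  have hΛ : (Λ : Measure α) = Λ.mass • (Λ.normalize : Measure α) := by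
    conv_lhs => rw [Λ.self_eq_mass_smul_normalize]
    rfl
  rw [poissonPointLaw, integral_prod]
  · simp_rw [integral_cexp_sum_infinitePi _ (fun _ => hg), Finset.prod_const, Finset.card_range]
    rw [integral_poissonMeasure, hΛ, integral_smul_nnreal_measure,
      integral_sub hint (integrable_const _)]
    set w := ∫ x, Complex.exp ((g x : ℂ) * Complex.I) ∂(Λ.normalize : Measure α)
    simp only [integral_const, probReal_univ, one_smul]
    have hs := (NormedSpace.expSeries_div_hasSum_exp ((Λ.mass : ℂ) * w)).mul_left
      (Complex.exp (-(Λ.mass : ℂ)))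
    rw [← Complex.exp_eq_exp_ℂ, ← Complex.exp_add] at hs
    rw [NNReal.smul_def, Complex.real_smul]
    convert hs.tsum_eq using 1
    · refine tsum_congr fun k => ?_
      rw [Complex.real_smul]
      push_cast
      rw [mul_pow]
      ring
    · congr 1
      ring
  · refine Integrable.of_bound ?_ 1 (Eventually.of_forall fun x => by
      rw [Complex.norm_exp_ofReal_mul_I])
    exact ((Complex.measurable_ofReal.comp (measurable_sum_range_fst hg)).mul_const
      _).cexp.aestronglyMeasurable

/-! ### Compound Poisson processes -/

theorem HasIncrementExponent.sum_infinitePi {S E : Type*} [MeasurableSpace S]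
    [NormedAddCommGroup E] [InnerProductSpace ℝ E] [MeasurableSpace E] [BorelSpace E]
    [SecondCountableTopology E] {ρ : ℕ → Measure S} [∀ k, IsProbabilityMeasure (ρ k)]
    {Z : ℕ → ℝ≥0 → S → E} {b : ℕ → ℝ≥0 → ℝ≥0 → E → ℝ}
    (h : ∀ k, HasIncrementExponent (ρ k) (Z k) (b k)) (hZ : ∀ k t, Measurable (Z k t)) (N : ℕ) :
    HasIncrementExponent (Measure.infinitePi ρ)
      (fun t ω => ∑ k ∈ Finset.range N, Z k t (ω k))
      (fun s t ξ => ∑ k ∈ Finset.range N, b k s t ξ) := by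
  intro n t ht ξ
  have := integral_cexp_sum_infinitePi ρ (g := fun k x =>
    ∑ i, inner ℝ (Z k (t i.succ) x - Z k (t i.castSucc) x) (ξ i)) (fun k => by fun_prop) N
  simp_rw [fun k => h k n t ht ξ, ← Complex.exp_sum, ← Complex.ofReal_sum] at this
  rw [Finset.sum_comm] at this
  rw [← this]
  congr 1 with ω
  rw [Finset.sum_comm]
  simp_rw [← Finset.sum_sub_distrib, sum_inner]

/-- The value at time `t` of the compound Poisson path whose jump times and jump sizes are the
points of the configuration `ω` in `ℝ × E`; points with nonpositive time are ignored. -/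
noncomputable def jumpSum {E : Type*} [AddCommMonoid E] (t : ℝ≥0) (ω : ℕ × (ℕ → ℝ × E)) : E :=
  ∑ j ∈ Finset.range ω.1, (Ioc 0 (t : ℝ) ×ˢ (univ : Set E)).indicator Prod.snd (ω.2 j)

section

variable {E : Type*} [NormedAddCommGroup E]

theorem measurable_jumpSum [MeasurableSpace E] [BorelSpace E] [SecondCountableTopology E]
    (t : ℝ≥0) : Measurable (jumpSum (E := E) t) :=
  measurable_sum_range_fst (measurable_snd.indicator (measurableSet_Ioc.prod .univ))

theorem indicator_Ioc_prod_sub {s t : ℝ≥0} (hst : s ≤ t) (x : ℝ × E) :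
    (Ioc 0 (t : ℝ) ×ˢ (univ : Set E)).indicator Prod.snd x -
      (Ioc 0 (s : ℝ) ×ˢ (univ : Set E)).indicator Prod.snd x =
      (Ioc (s : ℝ) t ×ˢ (univ : Set E)).indicator Prod.snd x := by
  have h : (s : ℝ) ≤ t := hst
  have hs : (0 : ℝ) ≤ s := s.2
  simp only [indicator, mem_prod, mem_Ioc, mem_univ, and_true]
  split_ifs <;> first | (exfalso; grind) | simp

theorem jumpSum_sub_jumpSum {s t : ℝ≥0} (hst : s ≤ t) (ω : ℕ × (ℕ → ℝ × E)) :
    jumpSum t ω - jumpSum s ω =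
      ∑ j ∈ Finset.range ω.1, (Ioc (s : ℝ) t ×ˢ (univ : Set E)).indicator Prod.snd (ω.2 j) := by
  simp_rw [jumpSum, ← Finset.sum_sub_distrib, indicator_Ioc_prod_sub hst]

theorem isCadlagPath_sum {ι : Type*} (s : Finset ι) {f : ι → ℝ≥0 → E}
    (hf : ∀ i ∈ s, IsCadlagPath (f i)) : IsCadlagPath fun t => ∑ i ∈ s, f i t := by
  intro t
  choose! l hl using fun i (hi : i ∈ s) => (hf i hi t).2
  exact ⟨tendsto_finsetSum _ fun i hi => (hf i hi t).1, ∑ i ∈ s, l i,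
    tendsto_finsetSum _ fun i hi => hl i hi⟩

theorem isCadlagPath_indicator_Ioc_prod (x : ℝ × E) :
    IsCadlagPath fun t : ℝ≥0 => (Ioc 0 (t : ℝ) ×ˢ (univ : Set E)).indicator Prod.snd x := by
  intro t
  by_cases h0 : 0 < x.1
  · have hin : ∀ s : ℝ≥0, x.1 ≤ s →
        (Ioc 0 (s : ℝ) ×ˢ (univ : Set E)).indicator Prod.snd x = x.2 := fun s hs =>
      indicator_of_mem (by simp [h0, hs]) _
    have hout : ∀ s : ℝ≥0, (s : ℝ) < x.1 →
        (Ioc 0 (s : ℝ) ×ˢ (univ : Set E)).indicator Prod.snd x = 0 := fun s hs =>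
      indicator_of_notMem (by simp [hs]) _
    constructor
    · by_cases h : x.1 ≤ t
      · refine (continuousWithinAt_const (b := x.2)).congr (fun s hs => hin s ?_) (hin t h)
        exact h.trans (show (t : ℝ) ≤ s from hs)
      · push Not at h
        refine ContinuousAt.continuousWithinAt
          ((continuousAt_const (y := (0 : E))).congr ?_)
        have : ∀ᶠ s : ℝ≥0 in 𝓝 t, (s : ℝ) < x.1 :=
          (NNReal.continuous_coe.tendsto t).eventually (gt_mem_nhds h)
        filter_upwards [this] with s hs using (hout s hs).symm
    · by_cases h : x.1 < t
      · refine ⟨x.2, tendsto_const_nhds.congr' ?_⟩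
        have : ∀ᶠ s : ℝ≥0 in 𝓝[<] t, x.1 < s := mem_nhdsWithin_of_mem_nhds
          ((NNReal.continuous_coe.tendsto t).eventually (lt_mem_nhds h))
        filter_upwards [this] with s hs using (hin s hs.le).symm
      · push Not at h
        refine ⟨0, tendsto_const_nhds.congr' ?_⟩
        filter_upwards [self_mem_nhdsWithin] with s hs
        exact (hout s (lt_of_lt_of_le (show (s : ℝ) < t from hs) h)).symm
  · have : ∀ s : ℝ≥0, (Ioc 0 (s : ℝ) ×ˢ (univ : Set E)).indicator Prod.snd x = 0 := fun s =>
      indicator_of_notMem (by simp [h0]) _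
    simp_rw [this]
    exact ⟨continuousWithinAt_const, 0, tendsto_const_nhds⟩

theorem isCadlagPath_jumpSum (ω : ℕ × (ℕ → ℝ × E)) : IsCadlagPath fun t => jumpSum t ω :=
  isCadlagPath_sum _ fun _ _ => isCadlagPath_indicator_Ioc_prod _

theorem IsCadlagPath.of_tendstoUniformlyOn [CompleteSpace E] {F : ℕ → ℝ≥0 → E} {f : ℝ≥0 → E}
    (hF : ∀ n, IsCadlagPath (F n)) (hlim : ∀ M : ℕ, TendstoUniformlyOn F f atTop (Iic (M : ℝ≥0))) :
    IsCadlagPath f := by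
  intro t
  obtain ⟨M, hM⟩ := exists_nat_gt t
  have hnhds : Iic (M : ℝ≥0) ∈ 𝓝 t := Iic_mem_nhds hM
  constructor
  · refine continuousWithinAt_of_locally_uniform_approx_of_continuousWithinAt self_mem_Ici
      fun u hu => ?_
    obtain ⟨n, hn⟩ := (hlim M u hu).exists
    exact ⟨Iic (M : ℝ≥0), mem_nhdsWithin_of_mem_nhds hnhds, F n, (hF n t).1, hn⟩
  · rcases eq_or_neBot (𝓝[<] t) with hbot | hne
    · exact ⟨0, by simp [hbot]⟩
    choose l hl using fun n => (hF n t).2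
    have hu : TendstoUniformlyOnFilter F f atTop (𝓝[<] t) :=
      (tendstoUniformlyOn_iff_tendstoUniformlyOnFilter.1 (hlim M)).mono_right
        (le_principal_iff.2 (mem_nhdsWithin_of_mem_nhds hnhds))
    have hc : CauchySeq l := by
      refine Metric.cauchySeq_iff'.2 fun ε hε => ?_
      have hcau := (hlim M).uniformCauchySeqOn
      obtain ⟨K, hK⟩ := Metric.uniformCauchySeqOn_iff.1 hcau (ε / 2) (half_pos hε)
      refine ⟨K, fun n hn => lt_of_le_of_lt ?_ (half_lt_self hε)⟩
      refine le_of_tendsto ((hl n).dist (hl K)) ?_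
      filter_upwards [mem_nhdsWithin_of_mem_nhds hnhds] with s hs
      exact (hK n hn K le_rfl s hs).le
    obtain ⟨y, hy⟩ := cauchySeq_tendsto_of_complete hc
    exact ⟨y, hu.tendsto_of_eventually_tendsto (Eventually.of_forall hl) hy⟩

end

/-- For an intensity symmetric in the jump size, the imaginary part of the exponent cancels. -/
theorem integral_symm_cexp_inner {E : Type*} [NormedAddCommGroup E] [InnerProductSpace ℝ E]
    [MeasurableSpace E] [BorelSpace E] [SecondCountableTopology E] {Λ : Measure (ℝ × E)}
    [IsFiniteMeasure Λ] (hΛ : Λ.map (Prod.map id Neg.neg) = Λ) {I : Set ℝ} (hI : MeasurableSet I)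
    (ξ : E) :
    ∫ x in I ×ˢ univ, (Complex.exp ((inner ℝ x.2 ξ : ℂ) * Complex.I) - 1) ∂Λ =
      ((-∫ x in I ×ˢ univ, (1 - Real.cos (inner ℝ x.2 ξ)) ∂Λ : ℝ) : ℂ) := by
  have hm : Measurable fun x : ℝ × E => Complex.exp ((inner ℝ x.2 ξ : ℂ) * Complex.I) - 1 := by
    fun_prop
  have hint : Integrable (fun x : ℝ × E => Complex.exp ((inner ℝ x.2 ξ : ℂ) * Complex.I) - 1)
      (Λ.restrict (I ×ˢ univ)) :=
    Integrable.of_bound hm.aestronglyMeasurable 2 (Eventually.of_forall fun x =>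
      (norm_sub_le _ _).trans (by rw [Complex.norm_exp_ofReal_mul_I]; norm_num))
  set z := ∫ x in I ×ˢ univ, (Complex.exp ((inner ℝ x.2 ξ : ℂ) * Complex.I) - 1) ∂Λ with hz
  have hconj : (starRingEnd ℂ) z = z := by
    have hR : (Λ.restrict (I ×ˢ univ)).map (Prod.map id Neg.neg) = Λ.restrict (I ×ˢ univ) := by
      have : (Prod.map id Neg.neg : ℝ × E → ℝ × E) ⁻¹' (I ×ˢ univ) = I ×ˢ univ := by
        ext; simp
      conv_rhs => rw [← hΛ]
      rw [Measure.restrict_map (by fun_prop) (hI.prod .univ), this]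
    rw [hz, ← integral_conj]
    conv_rhs => rw [← hR]
    rw [integral_map (by fun_prop) hm.aestronglyMeasurable]
    congr 1 with x
    simp [← Complex.exp_conj, inner_neg_left]
  rw [← Complex.conj_eq_iff_re.1 hconj, hz, ← RCLike.re_eq_complex_re, ← integral_re hint,
    ← integral_neg]
  congr 2 with x
  simp [Complex.exp_ofReal_mul_I_re]

/-- The increments of a compound Poisson path: the functional tested in `HasIncrementExponent` is an
additive functional of the point process, and the slabs `(t i, t (i + 1)] × E` are disjoint, so that
Campbell's formula factorizes. -/
theorem hasIncrementExponent_jumpSum {E : Type*} [NormedAddCommGroup E] [InnerProductSpace ℝ E]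
    [MeasurableSpace E] [BorelSpace E] [SecondCountableTopology E] (Λ : FiniteMeasure (ℝ × E))
    (hΛ : (Λ : Measure (ℝ × E)).map (Prod.map id Neg.neg) = Λ) :
    HasIncrementExponent (poissonPointLaw Λ) (jumpSum (E := E))
      fun s t ξ =>
        -∫ x in Ioc (s : ℝ) t ×ˢ univ, (1 - Real.cos (inner ℝ x.2 ξ)) ∂(Λ : Measure _) := by
  intro n t ht ξ
  let J : Fin n → Set (ℝ × E) := fun i => Ioc (t i.castSucc : ℝ) (t i.succ) ×ˢ univ
  have hJ : ∀ i, MeasurableSet (J i) := fun i => measurableSet_Ioc.prod .univ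
  let g : ℝ × E → ℝ := fun x => ∑ i, (J i).indicator (fun x => inner ℝ x.2 (ξ i)) x
  have hg : Measurable g := by
    refine Finset.measurable_sum _ fun i _ => Measurable.indicator (by fun_prop) (hJ i)
  have hdisj : ∀ x i j, x ∈ J i → x ∈ J j → i = j := by
    have key : ∀ (x : ℝ × E) i j, x ∈ J i → x ∈ J j → ¬ i < j := by
      intro x i j hi hj hij
      have h1 : t i.succ ≤ t j.castSucc := ht (Fin.succ_le_castSucc_iff.2 hij)
      have h2 : (t i.succ : ℝ) ≤ t j.castSucc := h1
      exact absurd (hj.1.1.trans_le hi.1.2) (not_lt.2 h2)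
    intro x i j hi hj
    rcases lt_trichotomy i j with h | h | h
    exacts [absurd h (key x i j hi hj), h, absurd h (key x j i hj hi)]
  have hexp : ∀ x, Complex.exp ((g x : ℂ) * Complex.I) - 1 = ∑ i, (J i).indicator
      (fun x => Complex.exp ((inner ℝ x.2 (ξ i) : ℂ) * Complex.I) - 1) x := by
    intro x
    -- at most one of the indicators is nonzero
    by_cases hx : ∃ i, x ∈ J i
    · obtain ⟨i, hi⟩ := hx
      have h0 : ∀ j, j ≠ i → x ∉ J j := fun j hj hxj => hj (hdisj x j i hxj hi)
      rw [Fintype.sum_eq_single i fun j hj => indicator_of_notMem (h0 j hj) _]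
      simp only [g]
      rw [Fintype.sum_eq_single i fun j hj => indicator_of_notMem (h0 j hj) _]
      simp [indicator_of_mem hi]
    · push Not at hx
      simp only [g]
      rw [Finset.sum_eq_zero fun i _ => indicator_of_notMem (hx i) _,
        Finset.sum_eq_zero fun i _ => indicator_of_notMem (hx i) _]
      simp
  have hsum : ∀ ω : ℕ × (ℕ → ℝ × E),
      ∑ i, inner ℝ (jumpSum (t i.succ) ω - jumpSum (t i.castSucc) ω) (ξ i) =
        ∑ j ∈ Finset.range ω.1, g (ω.2 j) := by
    intro ω
    simp only [g]
    rw [Finset.sum_comm]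
    refine Finset.sum_congr rfl fun i _ => ?_
    rw [jumpSum_sub_jumpSum (ht Fin.castSucc_lt_succ.le), sum_inner]
    refine Finset.sum_congr rfl fun j _ => ?_
    by_cases h : ω.2 j ∈ J i
    · rw [indicator_of_mem h, indicator_of_mem h]
    · rw [indicator_of_notMem h, indicator_of_notMem h, inner_zero_left]
  simp_rw [hsum]
  rw [integral_cexp_poissonPointLaw Λ hg]
  simp_rw [hexp]
  rw [integral_finsetSum]
  · congr 1
    rw [Complex.ofReal_sum]
    refine Finset.sum_congr rfl fun i _ => ?_
    rw [integral_indicator (hJ i), integral_symm_cexp_inner hΛ measurableSet_Ioc]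
  · intro i _
    refine Integrable.indicator (Integrable.of_bound (by fun_prop) 2
      (Eventually.of_forall fun x => ?_)) (hJ i)
    exact (norm_sub_le _ _).trans (by rw [Complex.norm_exp_ofReal_mul_I]; norm_num)

/-! ### Maximal inequality in continuous time and tail bounds -/

/-- Lévy's maximal inequality in continuous time, for right-continuous processes with independent
symmetric increments: apply the discrete inequality along the dyadic subdivisions of `[0, M]`. The
strict inequality on the left makes the supremum over dyadic times sufficient. -/
theorem HasIncrementExponent.measure_exists_lt_norm_le {Ω E : Type*} [MeasurableSpace Ω]
    [NormedAddCommGroup E] [InnerProductSpace ℝ E] [MeasurableSpace E] [BorelSpace E]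
    [SecondCountableTopology E] [CompleteSpace E] {P : Measure Ω} [IsProbabilityMeasure P]
    {Y : ℝ≥0 → Ω → E} {c : ℝ≥0 → ℝ≥0 → E → ℝ} (h : HasIncrementExponent P Y c)
    (hY : ∀ t, Measurable (Y t)) (h0 : ∀ ω, Y 0 ω = 0)
    (hright : ∀ ω t, ContinuousWithinAt (fun t => Y t ω) (Ici t) t) {M : ℝ≥0} (hM : 0 < M)
    (ε : ℝ) :
    P {ω | ∃ t ≤ M, ε < ‖Y t ω‖} ≤ 2 * P {ω | ε ≤ ‖Y M ω‖} := by
  let A : ℕ → Set Ω := fun m => {ω | ∃ k ≤ 2 ^ m, ε ≤ ‖Y ((k : ℕ) * (M / 2 ^ m)) ω‖}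
  have hA : ∀ m, P (A m) ≤ 2 * P {ω | ε ≤ ‖Y M ω‖} := by
    intro m
    let t : ℕ → ℝ≥0 := fun k => k * (M / 2 ^ m)
    have ht : Monotone t := fun i j hij => by
      simp only [t]; gcongr
    have key := measure_exists_le_norm_sum_le (D := fun i ω => Y (t (i + 1)) ω - Y (t i) ω)
      (fun i => (hY _).sub (hY _)) ((h.hasIndepIncrements hY).nat ht)
      (fun i => h.map_neg_sub hY (ht i.le_succ)) ε (2 ^ m)
    simp_rw [fun ω k => Finset.sum_range_sub (fun i => Y (t i) ω) k] at key
    have e0 : t 0 = 0 := by simp [t]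
    have e1 : t (2 ^ m) = M := by simp only [t]; push_cast; field_simp
    simpa [e0, e1, h0, A, t] using key
  have hmono : Monotone A := by
    refine monotone_nat_of_le_succ fun m ω ⟨k, hk, hω⟩ => ⟨2 * k, ?_, ?_⟩
    · rw [pow_succ]; omega
    · convert hω using 3
      push_cast
      rw [pow_succ]
      field_simp
  have hsub : {ω | ∃ t ≤ M, ε < ‖Y t ω‖} ⊆ ⋃ m, A m := by
    rintro ω ⟨t, htM, ht⟩
    -- dyadic approximations of `t` from the right, inside `[0, M]`
    let s : ℕ → ℝ≥0 := fun m => ⌈t / (M / 2 ^ m)⌉₊ * (M / 2 ^ m)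
    have hpos : ∀ m : ℕ, 0 < M / 2 ^ m := fun m => by positivity
    have h1 : ∀ m, t ≤ s m := fun m => by
      have := Nat.le_ceil (t / (M / 2 ^ m))
      rwa [div_le_iff₀ (hpos m)] at this
    have h2 : ∀ m, s m ≤ t + M / 2 ^ m := fun m => by
      have := (Nat.ceil_lt_add_one (zero_le (a := t / (M / 2 ^ m)))).le
      calc s m ≤ (t / (M / 2 ^ m) + 1) * (M / 2 ^ m) := by simp only [s]; gcongr
        _ = t + M / 2 ^ m := by
          rw [add_mul, one_mul, div_mul_cancel₀ _ (hpos m).ne']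
    have hpow : Tendsto (fun m : ℕ => M / 2 ^ m) atTop (𝓝 0) := by
      have := (tendsto_pow_atTop_nhds_zero_of_lt_one (r := (2⁻¹ : ℝ≥0)) zero_le
        (by
          rw [← NNReal.coe_lt_coe]; norm_num)).const_mul M
      simpa [div_eq_mul_inv, inv_pow] using this
    have hs : Tendsto s atTop (𝓝[≥] t) := by
      refine tendsto_nhdsWithin_iff.2 ⟨?_, Eventually.of_forall h1⟩
      refine tendsto_of_tendsto_of_tendsto_of_le_of_le tendsto_const_nhds ?_ h1 h2
      simpa using hpow.const_add t
    have hev : ∀ᶠ m in atTop, ε < ‖Y (s m) ω‖ :=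
      (((hright ω t).tendsto.comp hs).norm).eventually (lt_mem_nhds ht)
    obtain ⟨m, hm⟩ := hev.exists
    refine mem_iUnion.2 ⟨m, ⌈t / (M / 2 ^ m)⌉₊, ?_, hm.le⟩
    rw [Nat.ceil_le, div_le_iff₀ (hpos m)]
    push_cast
    rw [mul_div_cancel₀ _ (by positivity)]
    exact htM
  calc P {ω | ∃ t ≤ M, ε < ‖Y t ω‖} ≤ P (⋃ m, A m) := measure_mono hsub
    _ = ⨆ m, P (A m) := hmono.measure_iUnion
    _ ≤ 2 * P {ω | ε ≤ ‖Y M ω‖} := iSup_le hA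

/-- A quadratic bound for `1 - charFun μ` near `0` bounds the tails of `μ`. The constant comes from
applying the one-dimensional truncation inequality to each coordinate at level `ε / (2 D)`. -/
theorem measureReal_le_norm_le_of_charFun {D : ℕ} {μ : Measure (EuclideanSpace ℝ (Fin D))}
    [IsProbabilityMeasure μ] {K : ℝ} (hμ : ∀ ξ, ‖1 - charFun μ ξ‖ ≤ K * ‖ξ‖ ^ 2) {ε : ℝ}
    (hε : 0 < ε) : μ.real {x | ε ≤ ‖x‖} ≤ 32 * D ^ 3 * K / ε ^ 2 := by
  rcases Nat.eq_zero_or_pos D with rfl | hD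
  · have : {x : EuclideanSpace ℝ (Fin 0) | ε ≤ ‖x‖} = ∅ := by
      ext x; simp [Subsingleton.elim x 0, hε]
    simp [this]
  have hD' : (0 : ℝ) < D := by exact_mod_cast hD
  set r : ℝ := ε / (2 * D) with hr
  have hrpos : 0 < r := by positivity
  have hK : 0 ≤ K := by
    have := (norm_nonneg _).trans (hμ (EuclideanSpace.single ⟨0, hD⟩ 1))
    simpa using this
  have hone : ∀ i, μ.real {x | r < |inner ℝ (EuclideanSpace.single i (1 : ℝ)) x|} ≤
      8 * K / r ^ 2 := by
    intro i
    refine (measureReal_abs_inner_gt_le_integral_charFun hrpos).trans ?_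
    have hb : ‖∫ t in -2 * r⁻¹..2 * r⁻¹,
        1 - charFun μ (t • (EuclideanSpace.single i (1 : ℝ)))‖ ≤
        (K * (2 * r⁻¹) ^ 2) * |2 * r⁻¹ - -2 * r⁻¹| := by
      refine intervalIntegral.norm_integral_le_of_norm_le_const fun t ht => (hμ _).trans ?_
      have : |t| ≤ 2 * r⁻¹ := by
        rw [uIoc_of_le (by have := inv_pos.2 hrpos; linarith)] at ht
        exact abs_le.2 ⟨by linarith [ht.1], ht.2⟩
      rw [norm_smul, Real.norm_eq_abs]
      simp only [PiLp.norm_single, norm_one, mul_one]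
      gcongr
    have e : |2 * r⁻¹ - -2 * r⁻¹| = 4 * r⁻¹ := by
      rw [abs_of_pos (by have := inv_pos.2 hrpos; linarith)]; ring
    rw [e] at hb
    calc 2⁻¹ * r * _ ≤ 2⁻¹ * r * ((K * (2 * r⁻¹) ^ 2) * (4 * r⁻¹)) := by gcongr
      _ = 8 * K / r ^ 2 := by field_simp; ring
  have hsub : {x : EuclideanSpace ℝ (Fin D) | ε ≤ ‖x‖} ⊆
      ⋃ i ∈ (Finset.univ : Finset (Fin D)),
        {x | r < |inner ℝ (EuclideanSpace.single i (1 : ℝ)) x|} := by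
    intro x hx
    by_contra hcon
    simp only [Finset.mem_univ, iUnion_true, mem_iUnion, mem_ofPred_eq, not_exists, not_lt] at hcon
    have h1 : ‖x‖ ≤ ∑ i, |inner ℝ (EuclideanSpace.single i (1 : ℝ)) x| := by
      have hx' : x = ∑ i, (inner ℝ (EuclideanSpace.single i (1 : ℝ)) x) •
          EuclideanSpace.single i (1 : ℝ) := by
        have := (EuclideanSpace.basisFun (Fin D) ℝ).sum_repr' x
        simpa using this.symm
      conv_lhs => rw [hx']
      refine (norm_sum_le _ _).trans (Finset.sum_le_sum fun i _ => ?_)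
      rw [norm_smul]
      simp
    have h2 : ∑ i, |inner ℝ (EuclideanSpace.single i (1 : ℝ)) x| ≤ D * r := by
      refine (Finset.sum_le_card_nsmul _ _ r fun i _ => hcon i).trans ?_
      simp
    have h3 : (D : ℝ) * r = ε / 2 := by rw [hr]; field_simp
    have : ε ≤ ‖x‖ := hx
    linarith
  calc μ.real {x | ε ≤ ‖x‖} ≤ μ.real (⋃ i ∈ (Finset.univ : Finset (Fin D)),
        {x | r < |inner ℝ (EuclideanSpace.single i (1 : ℝ)) x|}) :=
        measureReal_mono hsub (measure_ne_top _ _)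
    _ ≤ ∑ i, μ.real {x | r < |inner ℝ (EuclideanSpace.single i (1 : ℝ)) x|} :=
        measureReal_biUnion_finset_le _ _
    _ ≤ D * (8 * K / r ^ 2) := by
        refine (Finset.sum_le_card_nsmul _ _ _ fun i _ => hone i).trans ?_
        simp
    _ = 32 * D ^ 3 * K / ε ^ 2 := by rw [hr]; field_simp; ring

/-! ### Partition of the jump space -/

section JumpCell

variable {E : Type*} [NormedAddCommGroup E]

/-- The `k`-th cell of a partition of `(0, ∞) × (E ∖ {0})`: the space-time jumps with time at most
`k` and size greater than `a k` that do not belong to an earlier cell. For a Lévy measure the cells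
have finite intensity, and on `[0, M]` a cell of index `k ≥ M + 1` contains only jumps of size at
most `a (k - 1)`. -/
def jumpCell (a : ℕ → ℝ) (k : ℕ) : Set (ℝ × E) :=
  disjointed (fun k : ℕ => Ioc (0 : ℝ) k ×ˢ {x : E | a k < ‖x‖}) k

theorem measurableSet_jumpCell [MeasurableSpace E] [OpensMeasurableSpace E] (a : ℕ → ℝ) (k : ℕ) :
    MeasurableSet (jumpCell (E := E) a k) :=
  MeasurableSet.disjointed (fun _ => measurableSet_Ioc.prod
    (measurableSet_lt measurable_const measurable_norm)) k

theorem disjoint_jumpCell (a : ℕ → ℝ) :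
    Pairwise (Function.onFun Disjoint (jumpCell (E := E) a)) :=
  disjoint_disjointed _

theorem iUnion_jumpCell {a : ℕ → ℝ} (ha : Tendsto a atTop (𝓝 0)) (h0 : ∀ k, 0 < a k) :
    ⋃ k, jumpCell (E := E) a k = Ioi 0 ×ˢ {0}ᶜ := by
  unfold jumpCell
  rw [iUnion_disjointed]
  ext ⟨τ, x⟩
  simp only [mem_iUnion, mem_prod, mem_Ioc, mem_ofPred_eq, mem_Ioi, mem_compl_iff,
    mem_singleton_iff]
  constructor
  · rintro ⟨k, ⟨h1, -⟩, h2⟩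
    exact ⟨h1, norm_pos_iff.1 ((h0 k).trans h2)⟩
  · rintro ⟨h1, h2⟩
    obtain ⟨k, hk1, hk2⟩ := ((ha.eventually (gt_mem_nhds (norm_pos_iff.2 h2))).and
      (tendsto_natCast_atTop_atTop.eventually_ge_atTop τ)).exists
    exact ⟨k, ⟨h1, hk2⟩, hk1⟩

theorem jumpCell_subset (a : ℕ → ℝ) (k : ℕ) :
    jumpCell (E := E) a k ⊆ Ioc (0 : ℝ) k ×ˢ {x : E | a k < ‖x‖} :=
  disjointed_subset _ _

theorem jumpCell_succ_inter_subset (a : ℕ → ℝ) {j : ℕ} {M : ℝ} (hM : M ≤ j) :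
    jumpCell (E := E) a (j + 1) ∩ (Ioc 0 M ×ˢ univ) ⊆ Ioc 0 M ×ˢ Metric.closedBall 0 (a j) := by
  rintro ⟨τ, x⟩ ⟨hx, hτ⟩
  refine ⟨hτ.1, ?_⟩
  have h : (τ, x) ∉ Ioc (0 : ℝ) j ×ˢ {x : E | a j < ‖x‖} := by
    intro hcon
    have hd := disjointed_apply (fun k : ℕ => Ioc (0 : ℝ) k ×ˢ {x : E | a k < ‖x‖}) (j + 1)
    rw [jumpCell, hd] at hx
    refine hx.2 ?_
    exact (Finset.le_sup (f := fun k : ℕ => Ioc (0 : ℝ) k ×ˢ {x : E | a k < ‖x‖})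
      (Finset.mem_Iio.2 j.lt_succ_self)) hcon
  rw [mem_closedBall_zero_iff]
  by_contra hcon
  exact h ⟨⟨hτ.1.1, hτ.1.2.trans hM⟩, not_le.1 hcon⟩

theorem preimage_neg_jumpCell (a : ℕ → ℝ) (k : ℕ) :
    Prod.map id Neg.neg ⁻¹' jumpCell (E := E) a k = jumpCell a k := by
  ext ⟨τ, x⟩
  simp [jumpCell, disjointed_apply, Finset.sup_eq_iSup]

end JumpCell

theorem one_sub_cos_inner_le {E : Type*} [NormedAddCommGroup E] [InnerProductSpace ℝ E] (x ξ : E) :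
    1 - Real.cos (inner ℝ x ξ) ≤ ‖ξ‖ ^ 2 / 2 * ‖x‖ ^ 2 := by
  have h1 := Real.one_sub_sq_div_two_le_cos (x := inner ℝ x ξ)
  have h2 : (inner ℝ x ξ) ^ 2 ≤ (‖x‖ * ‖ξ‖) ^ 2 := by
    rw [← sq_abs]
    exact pow_le_pow_left₀ (abs_nonneg _) (abs_real_inner_le_norm x ξ) 2
  nlinarith

section LevyMeasure

variable {E : Type*} [NormedAddCommGroup E] [MeasurableSpace E] [BorelSpace E] {N : Measure E}

/-- For a Lévy measure the second moment of the jumps of size at most `a` tends to `0` with `a`.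
Here `N {0}` may be positive: the integrand vanishes at `0`. -/
theorem exists_radius_setLIntegral_sq_le
    (hN : ∫⁻ x, ENNReal.ofReal (min (‖x‖ ^ 2) 1) ∂N < ∞) {δ : ℝ≥0∞} (hδ : 0 < δ) (k : ℕ) :
    ∃ a : ℝ, 0 < a ∧ a ≤ 1 / ((k : ℝ) + 1) ∧
      ∫⁻ x in Metric.closedBall 0 a, ENNReal.ofReal (‖x‖ ^ 2) ∂N ≤ δ := by
  let m : Measure E := N.withDensity fun x => ENNReal.ofReal (min (‖x‖ ^ 2) 1)
  have : IsFiniteMeasure m := isFiniteMeasure_withDensity hN.ne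
  have hanti : Antitone fun n : ℕ => Metric.closedBall (0 : E) (1 / ((n : ℝ) + 1)) := by
    intro i j hij
    exact Metric.closedBall_subset_closedBall (by gcongr)
  have hlim := tendsto_measure_iInter_atTop (μ := m)
    (fun n : ℕ => (Metric.isClosed_closedBall (x := (0 : E))
      (ε := 1 / ((n : ℝ) + 1))).measurableSet.nullMeasurableSet) hanti ⟨0, measure_ne_top _ _⟩
  have hinter : ⋂ n : ℕ, Metric.closedBall (0 : E) (1 / ((n : ℝ) + 1)) = {0} := by
    ext x
    simp only [mem_iInter, mem_closedBall_zero_iff, mem_singleton_iff]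
    refine ⟨fun h => norm_le_zero_iff.1 (ge_of_tendsto tendsto_one_div_add_atTop_nhds_zero_nat
      (Eventually.of_forall h)), fun h n => ?_⟩
    rw [h, norm_zero]; positivity
  have hzero : m {0} = 0 := by
    rw [withDensity_apply _ (measurableSet_singleton 0),
      setLIntegral_congr_fun (g := fun _ => 0) (measurableSet_singleton 0)]
    · simp
    · intro x hx
      rw [mem_singleton_iff.1 hx]; simp
  rw [hinter, hzero] at hlim
  obtain ⟨n, hn, hkn⟩ := ((hlim.eventually (gt_mem_nhds hδ)).and (eventually_ge_atTop k)).exists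
  refine ⟨1 / ((n : ℝ) + 1), by positivity, by gcongr, ?_⟩
  refine le_trans (le_of_eq ?_) hn.le
  rw [Function.comp_apply, withDensity_apply _ Metric.isClosed_closedBall.measurableSet]
  refine setLIntegral_congr_fun Metric.isClosed_closedBall.measurableSet fun x hx => ?_
  have h1 : ‖x‖ ≤ 1 := (mem_closedBall_zero_iff.1 hx).trans (by
    rw [div_le_one (by positivity)]; linarith [(Nat.cast_nonneg n : (0 : ℝ) ≤ n)])
  have : ‖x‖ ^ 2 ≤ 1 := pow_le_one₀ (norm_nonneg _) h1
  simp [min_eq_left this]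

theorem measure_lt_norm_lt_top (hN : ∫⁻ x, ENNReal.ofReal (min (‖x‖ ^ 2) 1) ∂N < ∞) {a : ℝ}
    (ha : 0 < a) : N {x | a < ‖x‖} < ∞ := by
  have h := meas_ge_le_lintegral_div (μ := N)
    (f := fun x : E => ENNReal.ofReal (min (‖x‖ ^ 2) 1)) (by fun_prop)
    (ε := ENNReal.ofReal (min (a ^ 2) 1)) (by simp [ha.ne']) ENNReal.ofReal_ne_top
  refine (measure_mono fun x (hx : a < ‖x‖) => ?_).trans_lt
    (h.trans_lt (ENNReal.div_lt_top hN.ne (by simp [ha.ne'])))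
  change ENNReal.ofReal _ ≤ ENNReal.ofReal _
  gcongr

theorem integrable_one_sub_cos_inner [InnerProductSpace ℝ E] [SecondCountableTopology E]
    (hN : ∫⁻ x, ENNReal.ofReal (min (‖x‖ ^ 2) 1) ∂N < ∞)
    (ξ : E) : Integrable (fun x => 1 - Real.cos (inner ℝ x ξ)) N := by
  have hint : Integrable (fun x : E => min (‖x‖ ^ 2) 1) N := by
    refine ⟨by fun_prop, ?_⟩
    rw [hasFiniteIntegral_iff_ofReal (Eventually.of_forall fun x => by positivity)]
    exact hN
  refine (hint.const_mul (‖ξ‖ ^ 2 / 2 + 2)).mono' (by fun_prop) (Eventually.of_forall fun x => ?_)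
  have h0 := Real.cos_le_one (inner ℝ x ξ)
  have h0' := Real.neg_one_le_cos (inner ℝ x ξ)
  rw [Real.norm_of_nonneg (by linarith)]
  have h1 := one_sub_cos_inner_le x ξ
  rcases le_total (‖x‖ ^ 2) 1 with h | h
  · rw [min_eq_left h]; nlinarith [sq_nonneg ‖x‖]
  · rw [min_eq_right h]; nlinarith [sq_nonneg ‖ξ‖]

theorem measure_jumpCell_lt_top [SFinite N]
    (hN : ∫⁻ x, ENNReal.ofReal (min (‖x‖ ^ 2) 1) ∂N < ∞)
    {a : ℕ → ℝ} (h0 : ∀ k, 0 < a k) (k : ℕ) :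
    ((volume : Measure ℝ).prod N) (jumpCell a k) < ∞ := by
  refine (measure_mono (jumpCell_subset a k)).trans_lt ?_
  rw [Measure.prod_prod]
  exact ENNReal.mul_lt_top (by simp) (measure_lt_norm_lt_top hN (h0 k))

theorem map_neg_restrict_jumpCell [SFinite N] [SecondCountableTopology E]
    (hsymm : N.map Neg.neg = N) (a : ℕ → ℝ) (k : ℕ) :
    (((volume : Measure ℝ).prod N).restrict (jumpCell a k)).map (Prod.map id Neg.neg) =
      ((volume : Measure ℝ).prod N).restrict (jumpCell a k) := by
  have hmap : ((volume : Measure ℝ).prod N).map (Prod.map id Neg.neg) =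
      (volume : Measure ℝ).prod N := by
    rw [← Measure.map_prod_map _ _ measurable_id measurable_neg, hsymm, Measure.map_id]
  conv_rhs => rw [← hmap]
  rw [Measure.restrict_map (by fun_prop) (measurableSet_jumpCell a k), preimage_neg_jumpCell]

/-- The exponent at time `M` of the compound Poisson process built from a late cell is quadratically
small: all its jumps before time `M` have size at most `a j`. -/
theorem setIntegral_jumpCell_succ_le [InnerProductSpace ℝ E] [SFinite N] [SecondCountableTopology E]
    (a : ℕ → ℝ) {j : ℕ} {M : ℝ≥0} (hM : (M : ℝ) ≤ j) {δ : ℝ} (hδ : 0 ≤ δ)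
    (ha : ∫⁻ x in Metric.closedBall 0 (a j), ENNReal.ofReal (‖x‖ ^ 2) ∂N ≤ ENNReal.ofReal δ)
    (ξ : E) :
    ∫ x in Ioc 0 (M : ℝ) ×ˢ univ, (1 - Real.cos (inner ℝ x.2 ξ))
      ∂(((volume : Measure ℝ).prod N).restrict (jumpCell a (j + 1))) ≤
      M * δ / 2 * ‖ξ‖ ^ 2 := by
  rw [Measure.restrict_restrict (measurableSet_Ioc.prod .univ), inter_comm,
    integral_eq_lintegral_of_nonneg_ae (Eventually.of_forall fun x => by
      simpa using Real.cos_le_one _) (by fun_prop)]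
  refine ENNReal.toReal_le_of_le_ofReal (by positivity) ?_
  calc ∫⁻ x in jumpCell a (j + 1) ∩ Ioc 0 (M : ℝ) ×ˢ univ,
        ENNReal.ofReal (1 - Real.cos (inner ℝ x.2 ξ)) ∂((volume : Measure ℝ).prod N)
      ≤ ∫⁻ x in Ioc 0 (M : ℝ) ×ˢ Metric.closedBall 0 (a j),
        1 * (ENNReal.ofReal (‖ξ‖ ^ 2 / 2) * ENNReal.ofReal (‖x.2‖ ^ 2))
          ∂((volume : Measure ℝ).prod N) := by
        refine lintegral_mono' (Measure.restrict_mono (jumpCell_succ_inter_subset a hM) le_rfl)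
          fun x => ?_
        rw [one_mul, ← ENNReal.ofReal_mul (by positivity)]
        exact ENNReal.ofReal_le_ofReal (one_sub_cos_inner_le _ _)
    _ = ENNReal.ofReal M * (ENNReal.ofReal (‖ξ‖ ^ 2 / 2) *
        ∫⁻ x in Metric.closedBall 0 (a j), ENNReal.ofReal (‖x‖ ^ 2) ∂N) := by
        rw [← Measure.prod_restrict, lintegral_prod_mul (f := fun _ => 1)
          (g := fun x : E => ENNReal.ofReal (‖ξ‖ ^ 2 / 2) * ENNReal.ofReal (‖x‖ ^ 2))
          (by fun_prop) (by fun_prop), lintegral_const_mul _ (by fun_prop)]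
        simp
    _ ≤ ENNReal.ofReal M * (ENNReal.ofReal (‖ξ‖ ^ 2 / 2) * ENNReal.ofReal δ) := by gcongr
    _ = ENNReal.ofReal (M * δ / 2 * ‖ξ‖ ^ 2) := by
        rw [← ENNReal.ofReal_mul (by positivity), ← ENNReal.ofReal_mul (by positivity)]
        congr 1; ring

theorem hasSum_setIntegral_jumpCell [InnerProductSpace ℝ E] [SFinite N] [SecondCountableTopology E]
    (hN : ∫⁻ x, ENNReal.ofReal (min (‖x‖ ^ 2) 1) ∂N < ∞) {a : ℕ → ℝ}
    (ha : Tendsto a atTop (𝓝 0)) (h0 : ∀ k, 0 < a k) {s t : ℝ≥0} (hst : s ≤ t) (ξ : E) :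
    HasSum (fun k => ∫ x in Ioc (s : ℝ) t ×ˢ univ, (1 - Real.cos (inner ℝ x.2 ξ))
      ∂(((volume : Measure ℝ).prod N).restrict (jumpCell a k)))
      (((t : ℝ) - s) * ∫ x, (1 - Real.cos (inner ℝ x ξ)) ∂N) := by
  let f : ℝ × E → ℝ := fun x =>
    (Ioc (s : ℝ) t).indicator (fun _ => (1 : ℝ)) x.1 * (1 - Real.cos (inner ℝ x.2 ξ))
  have hind : Integrable ((Ioc (s : ℝ) t).indicator fun _ => (1 : ℝ)) :=
    (integrable_indicator_iff measurableSet_Ioc).2 (integrable_const _)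
  have hf : Integrable f ((volume : Measure ℝ).prod N) :=
    hind.mul_prod (integrable_one_sub_cos_inner hN ξ)
  have hsum := hasSum_integral_iUnion (measurableSet_jumpCell (E := E) a) (disjoint_jumpCell a)
    hf.integrableOn
  have htot : ∫ x in ⋃ k, jumpCell a k, f x ∂((volume : Measure ℝ).prod N) =
      ((t : ℝ) - s) * ∫ x, (1 - Real.cos (inner ℝ x ξ)) ∂N := by
    rw [setIntegral_eq_integral_of_forall_compl_eq_zero, integral_prod_mul
      ((Ioc (s : ℝ) t).indicator fun _ => (1 : ℝ)) fun x : E => 1 - Real.cos (inner ℝ x ξ),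
      integral_indicator measurableSet_Ioc]
    · have : (s : ℝ) ≤ t := hst
      simp [this]
    · rintro ⟨τ, x⟩ hx
      rw [iUnion_jumpCell ha h0] at hx
      simp only [mem_prod, mem_Ioi, mem_compl_iff, mem_singleton_iff, not_and_or, not_not] at hx
      rcases hx with hx | hx
      · have : τ ∉ Ioc (s : ℝ) t := fun h => hx (lt_of_le_of_lt s.2 h.1)
        simp [f, this]
      · simp [f, hx]
  rw [htot] at hsum
  have hk : ∀ k, ∫ x in jumpCell a k, f x ∂((volume : Measure ℝ).prod N) =
      ∫ x in Ioc (s : ℝ) t ×ˢ univ, (1 - Real.cos (inner ℝ x.2 ξ))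
        ∂(((volume : Measure ℝ).prod N).restrict (jumpCell a k)) := fun k => by
    rw [← integral_indicator (measurableSet_Ioc.prod .univ)]
    congr 1 with x
    by_cases hx : x.1 ∈ Ioc (s : ℝ) t <;> simp [f, indicator, hx, -mem_Ioc]
  simpa only [hk] using hsum

end LevyMeasure

/-! ### Existence of symmetric pure-jump Lévy processes -/

theorem jumpSum_zero {E : Type*} [NormedAddCommGroup E] (ω : ℕ × (ℕ → ℝ × E)) :
    jumpSum 0 ω = 0 := by
  simp [jumpSum]

/-- Uniform control of a compound Poisson path on `[0, M]` by a quadratic bound for its exponent at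
time `M`. -/
theorem poissonPointLaw_exists_lt_norm_jumpSum_le {D : ℕ}
    {Λ : FiniteMeasure (ℝ × EuclideanSpace ℝ (Fin D))}
    (hΛ : (Λ : Measure (ℝ × EuclideanSpace ℝ (Fin D))).map (Prod.map id Neg.neg) = Λ)
    {M : ℝ≥0} (hM : 0 < M) {K : ℝ}
    (hK : ∀ ξ : EuclideanSpace ℝ (Fin D), ∫ x in Ioc 0 (M : ℝ) ×ˢ univ,
      (1 - Real.cos (inner ℝ x.2 ξ)) ∂(Λ : Measure (ℝ × EuclideanSpace ℝ (Fin D))) ≤ K * ‖ξ‖ ^ 2)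
    {ε : ℝ} (hε : 0 < ε) :
    poissonPointLaw Λ {ω | ∃ t ≤ M, ε < ‖jumpSum t ω‖} ≤
      ENNReal.ofReal (64 * D ^ 3 * K / ε ^ 2) := by
  have hexp := hasIncrementExponent_jumpSum Λ hΛ
  have hmax := hexp.measure_exists_lt_norm_le measurable_jumpSum jumpSum_zero
    (fun ω t => (isCadlagPath_jumpSum ω t).1) hM ε
  refine hmax.trans ?_
  have hm := measurable_jumpSum (E := EuclideanSpace ℝ (Fin D)) M
  have hprob : IsProbabilityMeasure ((poissonPointLaw Λ).map (jumpSum M)) :=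
    Measure.isProbabilityMeasure_map hm.aemeasurable
  have hchar : ∀ ξ, ‖1 - charFun ((poissonPointLaw Λ).map (jumpSum M)) ξ‖ ≤ K * ‖ξ‖ ^ 2 := by
    intro ξ
    have h := hexp.charFun_sub measurable_jumpSum (zero_le (a := M)) ξ
    simp only [jumpSum_zero, sub_zero, NNReal.coe_zero] at h
    have h0 : 0 ≤ ∫ x in Ioc 0 (M : ℝ) ×ˢ univ, (1 - Real.cos (inner ℝ x.2 ξ))
        ∂(Λ : Measure (ℝ × EuclideanSpace ℝ (Fin D))) :=
      integral_nonneg fun x => by simpa using Real.cos_le_one _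
    change charFun ((poissonPointLaw Λ).map (jumpSum M)) ξ = _ at h
    rw [h, ← Complex.ofReal_exp, ← Complex.ofReal_one, ← Complex.ofReal_sub, Complex.norm_real,
      Real.norm_of_nonneg (by simpa using h0)]
    have := Real.add_one_le_exp (-∫ x in Ioc 0 (M : ℝ) ×ˢ univ, (1 - Real.cos (inner ℝ x.2 ξ))
        ∂(Λ : Measure (ℝ × EuclideanSpace ℝ (Fin D))))
    linarith [hK ξ]
  have htail := measureReal_le_norm_le_of_charFun hchar hε
  rw [map_measureReal_apply hm (measurableSet_le measurable_const measurable_norm)] at htail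
  have h2 : poissonPointLaw Λ {ω | ε ≤ ‖jumpSum M ω‖} ≤
      ENNReal.ofReal (32 * D ^ 3 * K / ε ^ 2) := by
    rw [← ofReal_measureReal]
    exact ENNReal.ofReal_le_ofReal htail
  calc 2 * poissonPointLaw Λ {ω | ε ≤ ‖jumpSum M ω‖}
      ≤ ENNReal.ofReal 2 * ENNReal.ofReal (32 * D ^ 3 * K / ε ^ 2) := by
        gcongr; simp
    _ = ENNReal.ofReal (64 * D ^ 3 * K / ε ^ 2) := by
        rw [← ENNReal.ofReal_mul (by norm_num)]
        congr 1; ring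

/-- **Existence of symmetric pure-jump Lévy processes.** The process is the sum of independent
compound Poisson processes, one for each cell of a partition of the jump space. The radii `a k` are
so small that the maximal inequality and the Borel–Cantelli lemma make the series of paths converge
uniformly on compact time intervals, almost surely; by symmetry no compensation of the small jumps
is needed. -/
theorem exists_isLevyProcess_hasCharExponent {D : ℕ} (N : Measure (EuclideanSpace ℝ (Fin D)))
    [SFinite N] (hsymm : N.map Neg.neg = N)
    (hN : ∫⁻ x, ENNReal.ofReal (min (‖x‖ ^ 2) 1) ∂N < ∞) :
    ∃ (Ω : Type) (_ : MeasurableSpace Ω) (P : Measure Ω) (_ : IsProbabilityMeasure P)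
      (X : ℝ≥0 → Ω → EuclideanSpace ℝ (Fin D)),
      IsLevyProcess P X ∧
        HasCharExponent P X fun ξ => ∫ x, (1 - Real.cos (inner ℝ x ξ)) ∂N := by
  set E := EuclideanSpace ℝ (Fin D) with hE
  choose a ha0 ha1 haN using fun k => exists_radius_setLIntegral_sq_le hN
    (δ := ENNReal.ofReal ((1 / 8) ^ k)) (by positivity) k
  have halim : Tendsto a atTop (𝓝 0) := squeeze_zero (fun k => (ha0 k).le) ha1
    tendsto_one_div_add_atTop_nhds_zero_nat
  let Λ : ℕ → FiniteMeasure (ℝ × E) := fun k =>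
    ⟨((volume : Measure ℝ).prod N).restrict (jumpCell a k),
      ⟨by simpa using measure_jumpCell_lt_top hN ha0 k⟩⟩
  have hΛ : ∀ k, (Λ k : Measure (ℝ × E)) =
    ((volume : Measure ℝ).prod N).restrict (jumpCell a k) := fun _ => rfl
  have hΛsymm : ∀ k, (Λ k : Measure (ℝ × E)).map (Prod.map id Neg.neg) = Λ k := fun k =>
    map_neg_restrict_jumpCell hsymm a k
  let P : Measure (ℕ → ℕ × (ℕ → ℝ × E)) := Measure.infinitePi fun k => poissonPointLaw (Λ k)
  let S : ℕ → ℝ≥0 → (ℕ → ℕ × (ℕ → ℝ × E)) → E := fun n t ω =>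
    ∑ k ∈ Finset.range n, jumpSum t (ω k)
  let X : ℝ≥0 → (ℕ → ℕ × (ℕ → ℝ × E)) → E := fun t ω => limUnder atTop fun n => S n t ω
  have hSm : ∀ n t, Measurable (S n t) := fun n t =>
    Finset.measurable_sum _ fun k _ => (measurable_jumpSum t).comp (measurable_pi_apply k)
  have hXm : ∀ t, Measurable (X t) := fun t =>
    (StronglyMeasurable.limUnder fun n => (hSm n t).stronglyMeasurable).measurable
  -- by Borel–Cantelli, `8⁻¹ ^ k` against the squared threshold `(2⁻¹ ^ k) ^ 2` leaves a summable
  -- `2⁻¹ ^ k`; the index shift by `M + 2` ensures that only late cells occur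
  have hBC : ∀ M : ℕ, ∀ᵐ ω ∂P, ∀ᶠ k in atTop, ∀ t ≤ ((M + 1 : ℕ) : ℝ≥0),
      ‖jumpSum t (ω k)‖ ≤ (1 / 2) ^ k := by
    intro M
    let B : ℕ → Set (ℕ → ℕ × (ℕ → ℝ × E)) := fun i =>
      {ω | ∃ t ≤ ((M + 1 : ℕ) : ℝ≥0), (1 / 2) ^ (i + M + 1 + 1) < ‖jumpSum t (ω (i + M + 1 + 1))‖}
    have hB : ∀ i, P (B i) ≤
        ENNReal.ofReal (128 * D ^ 3 * (M + 1 : ℕ) * (1 / 2) ^ (i + M + 1)) := by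
      intro i
      have hle := Measure.le_map_apply
        (measurable_pi_apply (X := fun _ => ℕ × (ℕ → ℝ × E)) (i + M + 1 + 1)).aemeasurable (μ := P)
        {ω | ∃ t ≤ ((M + 1 : ℕ) : ℝ≥0), (1 / 2) ^ (i + M + 1 + 1) < ‖jumpSum t ω‖}
      refine hle.trans ?_
      have hev : P.map (fun ω => ω (i + M + 1 + 1)) = poissonPointLaw (Λ (i + M + 1 + 1)) :=
        Measure.infinitePi_map_eval (fun k => poissonPointLaw (Λ k)) _
      rw [hev]
      refine (poissonPointLaw_exists_lt_norm_jumpSum_le (hΛsymm _) (by positivity) (fun ξ =>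
        setIntegral_jumpCell_succ_le a (j := i + M + 1) ?_ (by positivity) (haN _) ξ)
        (by positivity)).trans (le_of_eq ?_)
      · push_cast; linarith [(Nat.cast_nonneg i : (0 : ℝ) ≤ i)]
      · congr 1
        have : ((1 : ℝ) / 8) ^ (i + M + 1) =
            (1 / 2) ^ (i + M + 1) * ((1 / 2) ^ (i + M + 1)) ^ 2 := by
          rw [← pow_mul, ← pow_add, show (1 / 8 : ℝ) = (1 / 2) ^ 3 by norm_num, ← pow_mul]
          congr 1; ring
        rw [this, pow_succ (1 / 2 : ℝ) (i + M + 1)]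
        have hp : ((1 : ℝ) / 2) ^ (i + M + 1) ≠ 0 := by positivity
        rw [NNReal.coe_natCast]
        field_simp
        ring
    have hsum : ∑' i, P (B i) ≠ ∞ := by
      refine ne_top_of_le_ne_top ?_ (ENNReal.tsum_le_tsum hB)
      rw [← ENNReal.ofReal_tsum_of_nonneg (fun i => by positivity)]
      · exact ENNReal.ofReal_ne_top
      · simp_rw [add_assoc, pow_add (1 / 2 : ℝ)]
        exact (summable_geometric_two.mul_right _).mul_left _
    filter_upwards [ae_eventually_notMem hsum] with ω hω
    obtain ⟨i₀, hi₀⟩ := eventually_atTop.1 hω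
    refine eventually_atTop.2 ⟨i₀ + M + 1 + 1, fun k hk t ht => ?_⟩
    by_contra! hcon
    refine hi₀ (k - (M + 1 + 1)) (by omega) ⟨t, ht, ?_⟩
    rwa [show k - (M + 1 + 1) + M + 1 + 1 = k by omega]
  have hunif : ∀ᵐ ω ∂P, ∀ M : ℕ, TendstoUniformlyOn (fun n t => S n t ω) (fun t => X t ω) atTop
      (Iic (M : ℝ≥0)) := by
    filter_upwards [ae_all_iff.2 hBC] with ω hω
    have key : ∀ M : ℕ, TendstoUniformlyOn (fun n t => S n t ω)
        (fun t => ∑' k, jumpSum t (ω k)) atTop (Iic (M : ℝ≥0)) := fun M => by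
      refine tendstoUniformlyOn_tsum_nat_eventually summable_geometric_two ?_
      filter_upwards [hω M] with k hk t ht
      exact hk t ((show t ≤ M from ht).trans (by push_cast; exact le_self_add))
    have hX : ∀ t, X t ω = ∑' k, jumpSum t (ω k) := fun t => by
      obtain ⟨M, hM⟩ := exists_nat_ge t
      exact ((key M).tendsto_at hM).limUnder_eq
    simp_rw [hX]
    exact key
  have hlim : ∀ᵐ ω ∂P, ∀ t, Tendsto (fun n => S n t ω) atTop (𝓝 (X t ω)) := by
    filter_upwards [hunif] with ω hω t
    obtain ⟨M, hM⟩ := exists_nat_ge t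
    exact (hω M).tendsto_at hM
  let c : ℝ≥0 → ℝ≥0 → E → ℝ := fun s t ξ =>
    -(((t : ℝ) - s) * ∫ x, (1 - Real.cos (inner ℝ x ξ)) ∂N)
  have hexp : HasIncrementExponent P X c := by
    refine HasIncrementExponent.of_tendsto (fun n => HasIncrementExponent.sum_infinitePi
      (fun k => hasIncrementExponent_jumpSum (Λ k) (hΛsymm k)) (fun k t => measurable_jumpSum t) n)
      hSm hlim fun s t ξ hst => ?_
    simp_rw [Finset.sum_neg_distrib]
    exact (hasSum_setIntegral_jumpCell hN halim ha0 hst ξ).tendsto_sum_nat.neg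
  have hX0 : ∀ ω, X 0 ω = 0 := fun ω => by
    have h0 : ∀ n, S n 0 ω = 0 := fun n => Finset.sum_eq_zero fun k _ => jumpSum_zero _
    have h1 : Tendsto (fun n => S n 0 ω) atTop (𝓝 0) := by
      simp_rw [h0]; exact tendsto_const_nhds
    exact h1.limUnder_eq
  refine ⟨_, inferInstance, P, inferInstance, X, ⟨hXm, Eventually.of_forall hX0,
    hexp.hasIndepIncrements hXm, fun s h => ?_, ?_⟩, fun t ξ => ?_⟩
  · have h1 : Measurable fun ω => X (s + h) ω - X s ω := (hXm _).sub (hXm _)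
    have h2 : Measurable fun ω => X h ω - X 0 ω := (hXm _).sub (hXm _)
    have := Measure.isProbabilityMeasure_map (μ := P) h1.aemeasurable
    have := Measure.isProbabilityMeasure_map (μ := P) h2.aemeasurable
    refine Measure.ext_of_charFun (funext fun ξ => ?_)
    rw [hexp.charFun_sub hXm le_self_add, hexp.charFun_sub hXm zero_le]
    simp [c]
  · filter_upwards [hunif] with ω hω
    exact IsCadlagPath.of_tendstoUniformlyOn
      (fun n => isCadlagPath_sum _ fun k _ => isCadlagPath_jumpSum _) hω
  · have := hexp.charFun_sub hXm (zero_le (a := t)) ξ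
    simpa [hX0, c] using this

/-! ### Continuous densities by Fourier inversion -/

section FourierDensity

open scoped FourierTransform

variable {V : Type*} [NormedAddCommGroup V] [InnerProductSpace ℝ V] [FiniteDimensional ℝ V]
  [MeasurableSpace V] [BorelSpace V]

theorem nonneg_of_forall_integral_contDiffBump_mul_nonneg {u : V → ℝ} (hu : Continuous u)
    (h : ∀ (x : V) (φ : ContDiffBump x), 0 ≤ ∫ y, φ y * u y) (x : V) : 0 ≤ u x := by
  by_contra! hx
  obtain ⟨δ, hδ, hball⟩ := Metric.continuousAt_iff.1 hu.continuousAt (-(u x) / 2) (by linarith)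
  let φ : ContDiffBump x := ⟨δ / 2, δ, by positivity, by linarith⟩
  have hle : ∫ y, φ y * u y ≤ ∫ y, φ y * (u x / 2) := by
    refine integral_mono ?_ ?_ fun y => ?_
    · exact (φ.continuous.mul hu).integrable_of_hasCompactSupport φ.hasCompactSupport.mul_right
    · exact φ.integrable.mul_const _
    · by_cases hy : y ∈ Metric.ball x δ
      · have := hball hy
        rw [Real.dist_eq] at this
        have := (abs_lt.1 this).2
        exact mul_le_mul_of_nonneg_left (by linarith) φ.nonneg
      · have : φ y = 0 := φ.zero_of_le_dist (not_lt.1 hy)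
        simp [this]
  rw [integral_mul_const] at hle
  have := φ.integral_pos (μ := volume)
  nlinarith [h x φ]

/-- Parseval's formula: a measure with integrable characteristic function acts on Schwartz functions
as the inverse Fourier transform of (a rescaling of) that function. -/
theorem integral_schwartz_eq_integral_mul_fourierInv {μ : Measure V} [IsProbabilityMeasure μ]
    {Φ : V → ℂ} (hΦdef : Φ = VectorFourier.fourierIntegral Real.fourierChar μ (innerₗ V) 1)
    (hΦ : Integrable Φ) (G : SchwartzMap V ℂ) :
    ∫ v, G v ∂μ = ∫ v, G v * 𝓕⁻ Φ v := by
  have h1 := VectorFourier.integral_fourierIntegral_smul_eq_flip (μ := volume) (ν := μ)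
    (e := Real.fourierChar) (L := innerₗ V) (f := (𝓕⁻ G : SchwartzMap V ℂ)) (g := (1 : V → ℂ))
    Real.continuous_fourierChar continuous_inner (𝓕⁻ G).integrable (integrable_const _)
  have h2 := VectorFourier.integral_fourierIntegral_smul_eq_flip (μ := volume) (ν := volume)
    (e := Real.fourierChar) (L := -innerₗ V) (f := G) (g := Φ)
    Real.continuous_fourierChar (by
      have : Continuous fun p : V × V => -(inner ℝ p.1 p.2 : ℝ) := by fun_prop
      simpa using this) G.integrable hΦ
  rw [flip_innerₗ, ← hΦdef] at h1
  have e1 : VectorFourier.fourierIntegral Real.fourierChar volume (innerₗ V)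
      (𝓕⁻ G : SchwartzMap V ℂ) = G := by
    have : 𝓕 (𝓕⁻ G : SchwartzMap V ℂ) = G := by simp
    rw [← congrArg (fun g : SchwartzMap V ℂ => (g : V → ℂ)) this]
    rfl
  have e2 : VectorFourier.fourierIntegral Real.fourierChar volume (-innerₗ V) G =
      (𝓕⁻ G : SchwartzMap V ℂ) := by
    rw [SchwartzMap.fourierInv_coe]; rfl
  have e3 : VectorFourier.fourierIntegral Real.fourierChar volume (-innerₗ V).flip Φ = 𝓕⁻ Φ := by
    ext v
    simp [VectorFourier.fourierIntegral, Real.fourierInv_eq, real_inner_comm]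
  rw [e1] at h1
  rw [e2, e3] at h2
  simp only [Pi.one_apply, smul_eq_mul, mul_one] at h1 h2
  rw [h1, h2]

/-- A probability measure with integrable characteristic function has a continuous density. The
candidate `F` is given by Fourier inversion; testing against smooth bumps shows that it is real,
nonnegative and integrable, and then both measures have the same characteristic function. -/
theorem exists_continuous_density_of_integrable_charFun (μ : Measure V) [IsProbabilityMeasure μ]
    (hμ : Integrable (charFun μ)) :
    ∃ f : V → ℝ, Continuous f ∧ (∀ x, 0 ≤ f x) ∧
      μ = volume.withDensity fun x => ENNReal.ofReal (f x) := by
  set Φ := VectorFourier.fourierIntegral Real.fourierChar μ (innerₗ V) (1 : V → ℂ) with hΦdef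
  have hchar : ∀ t, charFun μ t = Φ (-(2 * Real.pi)⁻¹ • t) := charFun_eq_fourierIntegral'
  have hΦchar : Φ = fun w => charFun μ ((-(2 * Real.pi)) • w) := by
    ext w
    rw [hchar, smul_smul]
    have : -(2 * Real.pi)⁻¹ * -(2 * Real.pi) = 1 := by
      have := Real.pi_ne_zero
      field_simp
    rw [this, one_smul]
  have hΦint : Integrable Φ := by
    rw [hΦchar]
    exact hμ.comp_smul (by simp [Real.pi_ne_zero])
  have hΦcont : Continuous Φ := by
    rw [hΦchar]
    exact continuous_charFun.comp (by fun_prop)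
  set F := 𝓕⁻ Φ with hF
  have hFneg : F = fun v => 𝓕 Φ (-v) := by ext v; rw [hF, Real.fourierInv_eq_fourier_neg]
  have hFcont : Continuous F := by
    have : Continuous (𝓕 Φ) := VectorFourier.fourierIntegral_continuous
      Real.continuous_fourierChar continuous_inner hΦint
    rw [hFneg]
    exact this.comp continuous_neg
  have htest : ∀ (x : V) (φ : ContDiffBump x),
      ∫ y, (φ y : ℂ) * F y = ((∫ y, φ y ∂μ : ℝ) : ℂ) := by
    intro x φ
    have hc : HasCompactSupport fun y => (φ y : ℂ) :=
      φ.hasCompactSupport.comp_left Complex.ofReal_zero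
    have hd : ContDiff ℝ (⊤ : ℕ∞) fun y => (φ y : ℂ) :=
      Complex.ofRealCLM.contDiff.comp φ.contDiff
    have := integral_schwartz_eq_integral_mul_fourierInv hΦdef hΦint (hc.toSchwartzMap hd)
    rw [← integral_complex_ofReal]
    exact this.symm
  have hcint : ∀ (x : V) (φ : ContDiffBump x), Integrable fun y => (φ y : ℂ) * F y := by
    intro x φ
    refine ((Complex.continuous_ofReal.comp φ.continuous).mul
      hFcont).integrable_of_hasCompactSupport ?_
    exact (φ.hasCompactSupport.comp_left Complex.ofReal_zero).mul_right
  have hre : ∀ (x : V) (φ : ContDiffBump x), ∫ y, φ y * (F y).re = ∫ y, φ y ∂μ := by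
    intro x φ
    have := congrArg Complex.re (htest x φ)
    rw [← RCLike.re_eq_complex_re, ← integral_re (hcint x φ)] at this
    simpa using this
  have him : ∀ (x : V) (φ : ContDiffBump x), ∫ y, φ y * (F y).im = 0 := by
    intro x φ
    have := congrArg Complex.im (htest x φ)
    rw [← RCLike.im_eq_complex_im, ← integral_im (hcint x φ)] at this
    simpa using this
  have hre0 : ∀ x, 0 ≤ (F x).re := nonneg_of_forall_integral_contDiffBump_mul_nonneg
    (Complex.continuous_re.comp hFcont) fun x φ => by
      rw [hre]; exact integral_nonneg fun y => φ.nonneg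
  have him0 : ∀ x, (F x).im = 0 := by
    intro x
    refine le_antisymm ?_ (nonneg_of_forall_integral_contDiffBump_mul_nonneg
      (Complex.continuous_im.comp hFcont) (fun x φ => (him x φ).ge) x)
    have := nonneg_of_forall_integral_contDiffBump_mul_nonneg (u := fun y => -(F y).im)
      (Complex.continuous_im.comp hFcont).neg (fun x φ => by
        simp_rw [mul_neg, integral_neg, him, neg_zero, le_refl]) x
    linarith
  set f : V → ℝ := fun x => (F x).re with hf
  have hfcont : Continuous f := Complex.continuous_re.comp hFcont
  have hFf : ∀ x, F x = (f x : ℂ) := fun x => Complex.ext (by simp [hf]) (by simp [him0])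
  have hfint : Integrable f := by
    have hcov : AECover (volume : Measure V) atTop fun n : ℕ => Metric.closedBall (0 : V) n :=
      aecover_closedBall tendsto_natCast_atTop_atTop
    refine hcov.integrable_of_lintegral_enorm_bounded 1 hfcont.aestronglyMeasurable
      (Eventually.of_forall fun n => ?_)
    let φ : ContDiffBump (0 : V) := ⟨n + 1, n + 2, by positivity, by linarith⟩
    have hφint : Integrable fun y => φ y * f y :=
      (φ.continuous.mul hfcont).integrable_of_hasCompactSupport φ.hasCompactSupport.mul_right
    calc ∫⁻ x in Metric.closedBall (0 : V) n, ‖f x‖ₑ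
        ≤ ∫⁻ x in Metric.closedBall (0 : V) n, ENNReal.ofReal (φ x * f x) := by
          refine setLIntegral_mono' Metric.isClosed_closedBall.measurableSet fun x hx => ?_
          rw [φ.one_of_mem_closedBall (Metric.closedBall_subset_closedBall
            (by simp [φ]) hx), one_mul, Real.enorm_of_nonneg (hre0 x)]
      _ ≤ ∫⁻ x, ENNReal.ofReal (φ x * f x) := setLIntegral_le_lintegral _ _
      _ = ENNReal.ofReal (∫ x, φ x * f x) :=
          (ofReal_integral_eq_lintegral_ofReal hφint (Eventually.of_forall fun x =>
            mul_nonneg φ.nonneg (hre0 x))).symm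
      _ = ENNReal.ofReal (∫ x, φ x ∂μ) := by rw [hre]
      _ ≤ ENNReal.ofReal 1 := by
          refine ENNReal.ofReal_le_ofReal ?_
          calc ∫ x, φ x ∂μ ≤ ∫ _, (1 : ℝ) ∂μ := integral_mono
                (φ.continuous.integrable_of_hasCompactSupport φ.hasCompactSupport)
                (integrable_const _) fun x => φ.le_one
            _ = 1 := by simp
  have hFint : Integrable F := by
    have : F = fun x => (f x : ℂ) := funext hFf
    rw [this]; exact hfint.ofReal
  have hinv : 𝓕 F = Φ := by
    refine hΦcont.fourier_fourierInv_eq hΦint ?_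
    have : 𝓕 Φ = fun v => F (-v) := by ext v; simp [hFneg]
    rw [this]
    exact hFint.comp_neg
  refine ⟨f, hfcont, hre0, ?_⟩
  have : IsFiniteMeasure (volume.withDensity fun x => ENNReal.ofReal (f x)) :=
    isFiniteMeasure_withDensity_ofReal hfint.2
  refine Measure.ext_of_charFun (funext fun t => ?_)
  rw [hchar, ← hinv, charFun_eq_fourierIntegral', Real.fourier_eq, VectorFourier.fourierIntegral,
    integral_withDensity_eq_integral_toReal_smul (by fun_prop)
      (Eventually.of_forall fun x => ENNReal.ofReal_lt_top)]
  congr 1 with v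
  simp [hFf, Circle.smul_def, mul_comm]
  exact (ENNReal.toReal_ofReal (hre0 v)).symm

end FourierDensity

/-! ### Surface measure and the hat-box theorem -/

/-- Polar coordinates in the plane followed by the substitution `v = √(r ^ 2 + s ^ 2)`, for which
`v dv = s ds`. -/
theorem lintegral_complex_sqrt_add_norm_sq {r : ℝ} (hr : 0 ≤ r) {g : ℝ → ℝ≥0∞}
    (hg : Measurable g) :
    ∫⁻ z : ℂ, g √(r ^ 2 + ‖z‖ ^ 2) =
      ENNReal.ofReal (2 * Real.pi) * ∫⁻ v in Ioi r, ENNReal.ofReal v * g v := by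
  let f : ℝ → ℝ := fun s => √(r ^ 2 + s ^ 2)
  have hpos : ∀ s ∈ Ioi (0 : ℝ), 0 < r ^ 2 + s ^ 2 := fun s hs => by
    have : 0 < s := hs
    positivity
  have himage : f '' Ioi 0 = Ioi r := by
    ext v
    simp only [f, mem_image, mem_Ioi]
    constructor
    · rintro ⟨s, hs, rfl⟩
      exact Real.lt_sqrt_of_sq_lt (by nlinarith)
    · intro hv
      have h0 : 0 < v ^ 2 - r ^ 2 := by nlinarith
      refine ⟨√(v ^ 2 - r ^ 2), Real.sqrt_pos.2 h0, ?_⟩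
      rw [Real.sq_sqrt h0.le, add_sub_cancel, Real.sqrt_sq (hr.trans hv.le)]
  have hderiv : ∀ s ∈ Ioi (0 : ℝ), HasDerivWithinAt f (s / f s) (Ioi 0) s := fun s hs => by
    have h1 : HasDerivAt (fun s : ℝ => r ^ 2 + s ^ 2) (2 * s) s := by
      simpa using (hasDerivAt_pow 2 s).const_add (r ^ 2)
    have h2 := (h1.sqrt (hpos s hs).ne').hasDerivWithinAt (s := Ioi 0)
    rwa [mul_div_mul_left s _ two_ne_zero] at h2
  have hinj : InjOn f (Ioi 0) := fun s hs t ht hst => by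
    have hs' : 0 < s := hs
    have ht' : 0 < t := ht
    have := (Real.sqrt_inj (hpos s hs).le (hpos t ht).le).1 hst
    exact (pow_left_inj₀ hs'.le ht'.le two_ne_zero).1 (by linarith)
  have hsub : ∫⁻ v in Ioi r, ENNReal.ofReal v * g v =
      ∫⁻ s in Ioi (0 : ℝ), ENNReal.ofReal s * g (f s) := by
    rw [← himage, lintegral_image_eq_lintegral_abs_deriv_mul measurableSet_Ioi hderiv hinj]
    refine setLIntegral_congr_fun measurableSet_Ioi fun s hs => ?_
    have hs' : 0 < s := hs
    have hf : 0 < f s := Real.sqrt_pos.2 (hpos s hs)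
    rw [abs_of_pos (by positivity), ← mul_assoc, ← ENNReal.ofReal_mul (by positivity),
      div_mul_cancel₀ _ hf.ne']
  rw [hsub, ← Complex.lintegral_comp_polarCoord_symm, polarCoord_target, Measure.volume_eq_prod,
    ← Measure.prod_restrict]
  simp_rw [Complex.norm_polarCoord_symm, sq_abs, smul_eq_mul]
  have := lintegral_prod_mul (μ := volume.restrict (Ioi (0 : ℝ)))
    (ν := volume.restrict (Ioo (-Real.pi) Real.pi)) (f := fun s => ENNReal.ofReal s * g (f s))
    (g := fun _ => 1) (by fun_prop) (by fun_prop)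
  simp only [mul_one, lintegral_one, Measure.restrict_apply_univ, Real.volume_Ioo] at this
  rw [this, mul_comm]
  congr 2
  ring

section Slicing

variable {E E' : Type*} [NormedAddCommGroup E] [InnerProductSpace ℝ E] [FiniteDimensional ℝ E]
  [MeasurableSpace E] [BorelSpace E] [NormedAddCommGroup E'] [InnerProductSpace ℝ E']
  [FiniteDimensional ℝ E'] [MeasurableSpace E'] [BorelSpace E']

/-- Fubini's theorem along the two extra dimensions: the fibre above `y` is a plane, in which the
norm of the full vector runs over `(‖y‖, ∞)` with weight `2 π v dv`. The weight is this simple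
because there are exactly two extra dimensions. -/
theorem lintegral_fst_norm (L : E' ≃ₗᵢ[ℝ] WithLp 2 (E × ℂ)) {H : E → ℝ → ℝ≥0∞}
    (hH : Measurable (Function.uncurry H)) :
    ∫⁻ x, H (L x).fst ‖x‖ =
      ∫⁻ y, ENNReal.ofReal (2 * Real.pi) * ∫⁻ v in Ioi ‖y‖, ENNReal.ofReal v * H y v := by
  let K : WithLp 2 (E × ℂ) → ℝ≥0∞ := fun w => H w.fst ‖w‖
  have h1 : ∫⁻ x, H (L x).fst ‖x‖ = ∫⁻ w, K w := by
    rw [← L.measurePreserving.lintegral_comp_emb L.toHomeomorph.measurableEmbedding]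
    simp [K]
  have h2 : ∫⁻ w, K w = ∫⁻ p : E × ℂ, K (WithLp.toLp 2 p) :=
    ((WithLp.volume_preserving_toLp (U := E) (V := ℂ)).lintegral_comp_emb
      (MeasurableEquiv.toLp 2 (E × ℂ)).measurableEmbedding K).symm
  have h3 : ∀ p : E × ℂ, K (WithLp.toLp 2 p) = H p.1 √(‖p.1‖ ^ 2 + ‖p.2‖ ^ 2) := fun p => by
    simp [K, WithLp.prod_norm_eq_of_L2]
  rw [h1, h2]
  simp_rw [h3]
  rw [Measure.volume_eq_prod, lintegral_prod]
  · congr 1 with y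
    exact lintegral_complex_sqrt_add_norm_sq (norm_nonneg y)
      (hH.comp (measurable_const.prodMk measurable_id))
  · have : Measurable fun p : E × ℂ => (p.1, √(‖p.1‖ ^ 2 + ‖p.2‖ ^ 2)) := by fun_prop
    exact (hH.comp this).aemeasurable

end Slicing

section Sphere

open scoped Pointwise

variable {V : Type*} [NormedAddCommGroup V] [InnerProductSpace ℝ V] [FiniteDimensional ℝ V]
  [MeasurableSpace V] [BorelSpace V]

variable (V) in
/-- The surface measure of the unit sphere of `V`, as a measure on `V`. -/
noncomputable def sphereMeasure : Measure V :=
  (volume : Measure V).toSphere.map Subtype.val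

instance : IsFiniteMeasure (sphereMeasure V) := by
  unfold sphereMeasure; infer_instance

theorem lintegral_eq_lintegral_sphereMeasure [Nontrivial V] {H : V → ℝ≥0∞} (hH : Measurable H) :
    ∫⁻ x, H x = ∫⁻ r in Ioi (0 : ℝ), ENNReal.ofReal (r ^ (Module.finrank ℝ V - 1)) *
      ∫⁻ ω, H (r • ω) ∂(sphereMeasure V) := by
  have hm : Measurable fun p : Metric.sphere (0 : V) 1 × Ioi (0 : ℝ) => H (p.2.1 • p.1.1) :=
    hH.comp (by fun_prop)
  calc ∫⁻ x, H x = ∫⁻ x : ({(0)}ᶜ : Set V), H x.1 ∂((volume : Measure V).comap (↑)) := by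
        rw [lintegral_subtype_comap (measurableSet_singleton _).compl H, restrict_compl_singleton]
    _ = ∫⁻ p, H (p.2.1 • p.1.1) ∂((volume : Measure V).toSphere.prod
          (.volumeIoiPow (Module.finrank ℝ V - 1))) := by
        have h := (volume : Measure V).measurePreserving_homeomorphUnitSphereProd.lintegral_comp_emb
          (Homeomorph.measurableEmbedding _)
          (fun p : Metric.sphere (0 : V) 1 × Ioi (0 : ℝ) => H (p.2.1 • p.1.1))
        rw [← h]
        congr 1 with x
        have hx : ‖x.1‖ ≠ 0 := norm_ne_zero_iff.2 x.2
        simp [smul_smul, hx]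
    _ = ∫⁻ r, ∫⁻ ω, H (r.1 • ω.1) ∂(volume : Measure V).toSphere
          ∂(Measure.volumeIoiPow (Module.finrank ℝ V - 1)) :=
        lintegral_prod_symm _ hm.aemeasurable
    _ = ∫⁻ r : Ioi (0 : ℝ), ENNReal.ofReal (r.1 ^ (Module.finrank ℝ V - 1)) *
          ∫⁻ ω, H (r.1 • ω) ∂(sphereMeasure V) ∂(Measure.comap Subtype.val volume) := by
        rw [Measure.volumeIoiPow, lintegral_withDensity_eq_lintegral_mul _ (by fun_prop)
          (hm.lintegral_prod_left')]
        congr 1 with r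
        have hHr : Measurable fun ω : V => H (r.1 • ω) := hH.comp (by fun_prop)
        rw [sphereMeasure, lintegral_map hHr measurable_subtype_coe]
        rfl
    _ = _ := lintegral_subtype_comap measurableSet_Ioi fun r : ℝ =>
          ENNReal.ofReal (r ^ (Module.finrank ℝ V - 1)) *
            ∫⁻ ω, H (r • ω) ∂(sphereMeasure V)

theorem ae_sphereMeasure_norm_eq_one : ∀ᵐ ω ∂(sphereMeasure V), ‖ω‖ = 1 := by
  rw [sphereMeasure, ae_map_iff measurable_subtype_coe.aemeasurable
    (measurableSet_eq_fun measurable_norm measurable_const)]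
  exact Eventually.of_forall fun ω => mem_sphere_zero_iff_norm.1 ω.2

theorem sphereMeasure_map_linearIsometryEquiv (U : V ≃ₗᵢ[ℝ] V) :
    (sphereMeasure V).map U = sphereMeasure V := by
  have key : ∀ A : Set V, MeasurableSet A → sphereMeasure V A =
      Module.finrank ℝ V * volume (Ioo (0 : ℝ) 1 • (A ∩ Metric.sphere 0 1)) := by
    intro A hA
    rw [sphereMeasure, Measure.map_apply measurable_subtype_coe hA,
      Measure.toSphere_apply' _ (measurable_subtype_coe hA), Subtype.image_preimage_coe,
      inter_comm]
  ext A hA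
  have hUm : Measurable U := U.continuous.measurable
  rw [Measure.map_apply hUm hA, key _ hA, key _ (hUm hA)]
  congr 1
  rw [← U.measurePreserving.measure_preimage_emb U.toHomeomorph.measurableEmbedding
    (Ioo (0 : ℝ) 1 • (A ∩ Metric.sphere 0 1))]
  congr 1
  ext x
  simp only [Set.mem_smul, mem_inter_iff, mem_preimage, mem_sphere_zero_iff_norm]
  constructor
  · rintro ⟨r, hr, y, ⟨hy, hy1⟩, h⟩
    exact ⟨r, hr, U y, ⟨hy, by simpa using hy1⟩, by rw [← h, map_smul]⟩
  · rintro ⟨r, hr, y, ⟨hy, hy1⟩, h⟩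
    refine ⟨r, hr, U.symm y, ⟨by simpa using hy, by simpa using hy1⟩, ?_⟩
    rw [← map_smul, h, U.symm_apply_apply]

theorem setLIntegral_ball_eq_pow_mul {H : V → ℝ≥0∞} (hH : Measurable H) {r : ℝ} (hr : 0 < r) :
    ∫⁻ x in Metric.ball 0 r, H x = ENNReal.ofReal (r ^ Module.finrank ℝ V) *
      ∫⁻ x in Metric.ball 0 1, H (r • x) := by
  have hmap := Measure.map_addHaar_smul (volume : Measure V) (inv_ne_zero hr.ne')
  rw [abs_of_pos (by positivity), inv_pow, inv_inv] at hmap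
  have hHr : Measurable fun x : V => H (r • x) := hH.comp (by fun_prop)
  rw [← lintegral_indicator measurableSet_ball, ← lintegral_indicator measurableSet_ball,
    ← smul_eq_mul, ← lintegral_smul_measure, ← hmap,
    lintegral_map (hHr.indicator measurableSet_ball) (by fun_prop)]
  congr 1 with x
  have : r⁻¹ • x ∈ Metric.ball (0 : V) 1 ↔ x ∈ Metric.ball (0 : V) r := by
    rw [mem_ball_zero_iff, mem_ball_zero_iff, norm_smul, norm_inv, Real.norm_of_nonneg hr.le,
      inv_mul_lt_iff₀ hr, mul_one]
  by_cases hx : x ∈ Metric.ball (0 : V) r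
  · rw [indicator_of_mem hx, indicator_of_mem (this.2 hx), smul_inv_smul₀ hr.ne']
  · rw [indicator_of_notMem hx, indicator_of_notMem (mt this.1 hx)]

end Sphere

/-- **Archimedes' hat-box theorem**: the projection of the unit sphere of `E × ℂ` to `E` maps
surface measure to `2 π` times Lebesgue measure on the unit ball. Both sides are found by
integrating `1_{‖x‖ < 1} F(π x / ‖x‖)` over `E × ℂ`, in polar coordinates and fibrewise; the common
factor `κ` is the radial integral. -/
theorem lintegral_sphereMeasure_fst {E E' : Type*} [NormedAddCommGroup E] [InnerProductSpace ℝ E]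
    [FiniteDimensional ℝ E] [MeasurableSpace E] [BorelSpace E] [NormedAddCommGroup E']
    [InnerProductSpace ℝ E'] [FiniteDimensional ℝ E'] [MeasurableSpace E'] [BorelSpace E']
    (L : E' ≃ₗᵢ[ℝ] WithLp 2 (E × ℂ)) {F : E → ℝ≥0∞} (hF : Measurable F) :
    ∫⁻ ω, F (L ω).fst ∂(sphereMeasure E') =
      ENNReal.ofReal (2 * Real.pi) * ∫⁻ y in Metric.ball 0 1, F y := by
  have hdim : Module.finrank ℝ E' = Module.finrank ℝ E + 2 := by
    rw [L.toLinearEquiv.finrank_eq, (WithLp.linearEquiv 2 ℝ (E × ℂ)).finrank_eq,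
      Module.finrank_prod, Complex.finrank_real_complex]
  have : Nontrivial E' := Module.nontrivial_of_finrank_pos (R := ℝ) (by omega)
  set n := Module.finrank ℝ E
  let H : E → ℝ → ℝ≥0∞ := fun y v => (Ioo (0 : ℝ) 1).indicator 1 v * F (v⁻¹ • y)
  have hH : Measurable (Function.uncurry H) := by
    have h1 : Measurable fun p : E × ℝ => (Ioo (0 : ℝ) 1).indicator (1 : ℝ → ℝ≥0∞) p.2 :=
      (measurable_one.indicator measurableSet_Ioo).comp measurable_snd
    exact h1.mul (hF.comp (by fun_prop))
  set κ : ℝ≥0∞ := ∫⁻ r in Ioo (0 : ℝ) 1, ENNReal.ofReal (r ^ (n + 1)) with hκ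
  have hκ0 : κ ≠ 0 := by
    refine ((setLIntegral_pos_iff (by fun_prop)).2 ?_).ne'
    have : Ioo (0 : ℝ) 1 ⊆ Function.support (fun r : ℝ => ENNReal.ofReal (r ^ (n + 1))) ∩
        Ioo 0 1 := fun r hr => ⟨by simpa using pow_pos hr.1 (n + 1), hr⟩
    refine lt_of_lt_of_le ?_ (measure_mono this)
    simp
  have hκtop : κ ≠ ∞ := by
    refine ne_top_of_le_ne_top ENNReal.one_ne_top ?_
    calc κ ≤ ∫⁻ _ in Ioo (0 : ℝ) 1, 1 := setLIntegral_mono measurable_const fun r hr => by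
          rw [← ENNReal.ofReal_one]
          exact ENNReal.ofReal_le_ofReal (pow_le_one₀ hr.1.le hr.2.le)
      _ = 1 := by simp
  have hfst : Measurable fun x : E' => (L x).fst :=
    (WithLp.measurable_ofLp 2 (E × ℂ)).fst.comp L.continuous.measurable
  have hκC : ∀ C : ℝ≥0∞, ∫⁻ r in Ioi (0 : ℝ), ENNReal.ofReal (r ^ (n + 1)) *
      ((Ioo (0 : ℝ) 1).indicator 1 r * C) = κ * C := by
    intro C
    have hm : Measurable fun r : ℝ =>
        ENNReal.ofReal (r ^ (n + 1)) * (Ioo (0 : ℝ) 1).indicator 1 r :=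
      Measurable.mul (by fun_prop) (measurable_one.indicator measurableSet_Ioo)
    simp_rw [← mul_assoc]
    rw [lintegral_mul_const _ hm, hκ,
      ← lintegral_indicator measurableSet_Ioo, ← lintegral_indicator measurableSet_Ioi]
    congr 2 with r
    by_cases hr : r ∈ Ioo (0 : ℝ) 1
    · have : r ∈ Ioi (0 : ℝ) := hr.1
      simp [indicator_of_mem hr, indicator_of_mem this]
    · by_cases hr' : r ∈ Ioi (0 : ℝ) <;> simp [indicator, hr, hr', -mem_Ioo, -mem_Ioi]
  have hleft : ∫⁻ x, H (L x).fst ‖x‖ = κ * ∫⁻ ω, F (L ω).fst ∂(sphereMeasure E') := by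
    have hHm : Measurable fun x : E' => H (L x).fst ‖x‖ := hH.comp (hfst.prodMk measurable_norm)
    rw [lintegral_eq_lintegral_sphereMeasure hHm, hdim,
      ← hκC]
    refine setLIntegral_congr_fun measurableSet_Ioi fun r hr => ?_
    have hr' : 0 < r := hr
    change ENNReal.ofReal (r ^ (n + 2 - 1)) * _ = _
    congr 1
    have hFfst : Measurable fun ω : E' => F (L ω).fst := hF.comp hfst
    rw [← lintegral_const_mul _ hFfst]
    refine lintegral_congr_ae ?_
    filter_upwards [ae_sphereMeasure_norm_eq_one] with ω hω
    simp [H, norm_smul, hω, abs_of_pos hr', smul_smul, hr'.ne']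
  have hright : ∫⁻ y, ENNReal.ofReal (2 * Real.pi) * ∫⁻ v in Ioi ‖y‖, ENNReal.ofReal v * H y v =
      κ * (ENNReal.ofReal (2 * Real.pi) * ∫⁻ y in Metric.ball 0 1, F y) := by
    have hset : MeasurableSet {p : E × ℝ | ‖p.1‖ < p.2} :=
      measurableSet_lt (by fun_prop) (by fun_prop)
    have hJ : Measurable (Function.uncurry fun (y : E) (v : ℝ) =>
        (Ioi ‖y‖).indicator (fun v => ENNReal.ofReal v * H y v) v) := by
      have : (Function.uncurry fun (y : E) (v : ℝ) =>
          (Ioi ‖y‖).indicator (fun v => ENNReal.ofReal v * H y v) v) =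
          {p : E × ℝ | ‖p.1‖ < p.2}.indicator
            fun p => ENNReal.ofReal p.2 * Function.uncurry H p := by
        ext ⟨y, v⟩
        simp [Function.uncurry, indicator]
      rw [this]
      exact (Measurable.mul (by fun_prop) hH).indicator hset
    rw [lintegral_const_mul' _ _ ENNReal.ofReal_ne_top, mul_left_comm]
    congr 1
    simp_rw [← lintegral_indicator measurableSet_Ioi]
    rw [lintegral_lintegral_swap hJ.aemeasurable, ← hκC, ← lintegral_indicator measurableSet_Ioi]
    congr 1 with v
    by_cases hv : v ∈ Ioo (0 : ℝ) 1
    · have hv0 : v ∈ Ioi (0 : ℝ) := hv.1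
      have hv0' : 0 < v := hv.1
      have h1 : ∀ y : E, (Ioi ‖y‖).indicator (fun v => ENNReal.ofReal v * H y v) v =
          ENNReal.ofReal v * (Metric.ball (0 : E) v).indicator (fun y => F (v⁻¹ • y)) y := by
        intro y
        by_cases hy : ‖y‖ < v
        · rw [indicator_of_mem (show v ∈ Ioi ‖y‖ from hy),
            indicator_of_mem (mem_ball_zero_iff.2 hy)]
          simp [H, indicator_of_mem hv]
        · rw [indicator_of_notMem (show v ∉ Ioi ‖y‖ from hy),
            indicator_of_notMem (mt mem_ball_zero_iff.1 hy), mul_zero]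
      have hFv : Measurable fun y : E => F (v⁻¹ • y) := hF.comp (by fun_prop)
      simp_rw [h1]
      rw [lintegral_const_mul' _ _ ENNReal.ofReal_ne_top, lintegral_indicator measurableSet_ball,
        setLIntegral_ball_eq_pow_mul hFv hv0', indicator_of_mem hv0,
        indicator_of_mem hv, Pi.one_apply, one_mul, ← mul_assoc, ← ENNReal.ofReal_mul hv0'.le,
        ← pow_succ']
      simp_rw [inv_smul_smul₀ hv0'.ne']
      rfl
    · have h0 : (Ioo (0 : ℝ) 1).indicator (1 : ℝ → ℝ≥0∞) v = 0 := indicator_of_notMem hv _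
      have h1 : ∀ y : E, (Ioi ‖y‖).indicator (fun v => ENNReal.ofReal v * H y v) v = 0 := by
        intro y
        rw [indicator_apply]
        simp only [H, h0, zero_mul, mul_zero, ite_self]
      simp_rw [h1]
      rw [lintegral_zero, indicator_apply]
      simp only [h0, zero_mul, mul_zero, ite_self]
  have := lintegral_fst_norm L hH
  rw [hleft, hright] at this
  exact (ENNReal.mul_right_inj hκ0 hκtop).1 this

/-! ### Lifting radially decreasing measures by two dimensions -/

theorem volume_inter_ofReal_lt (a : ℝ≥0∞) :
    volume (Ioi (0 : ℝ) ∩ {h | ENNReal.ofReal h < a}) = a := by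
  rcases eq_or_ne a ∞ with rfl | ha
  · have : Ioi (0 : ℝ) ∩ {h | ENNReal.ofReal h < ∞} = Ioi 0 :=
      inter_eq_left.2 fun h _ => ENNReal.ofReal_lt_top
    rw [this, Real.volume_Ioi]
  · have : Ioi (0 : ℝ) ∩ {h | ENNReal.ofReal h < a} = Ioo 0 a.toReal := by
      ext h
      simp only [mem_inter_iff, mem_Ioi, mem_ofPred_eq, mem_Ioo, and_congr_right_iff]
      intro hh
      rw [ENNReal.ofReal_lt_iff_lt_toReal hh.le ha]
    rw [this, Real.volume_Ioo, sub_zero, ENNReal.ofReal_toReal ha]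

/-- The radius of the superlevel set `{r > 0 | h < n r}`, an interval starting at `0` if `n` is
antitone. The value is meaningful only if that set has finite length. -/
noncomputable def layerRadius (n : ℝ → ℝ≥0∞) (h : ℝ) : ℝ :=
  (volume {r : ℝ | 0 < r ∧ ENNReal.ofReal h < n r}).toReal

theorem layerRadius_nonneg (n : ℝ → ℝ≥0∞) (h : ℝ) : 0 ≤ layerRadius n h :=
  ENNReal.toReal_nonneg

theorem measurable_layerRadius (n : ℝ → ℝ≥0∞) : Measurable (layerRadius n) := by
  refine ENNReal.measurable_toReal.comp (Antitone.measurable fun h h' hh => ?_)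
  exact measure_mono fun r hr => ⟨hr.1, (ENNReal.ofReal_le_ofReal hh).trans_lt hr.2⟩

theorem le_layerRadius {n : ℝ → ℝ≥0∞} (hn : Antitone n)
    (hn0 : ∀ ε : ℝ, 0 < ε → ∃ r, n r ≤ ENNReal.ofReal ε) {h r : ℝ} (hh : 0 < h)
    (hlt : ENNReal.ofReal h < n r) : r ≤ layerRadius n h := by
  obtain ⟨R, hR⟩ := hn0 h hh
  have htop : volume {r : ℝ | 0 < r ∧ ENNReal.ofReal h < n r} ≠ ∞ := by
    have hsub : {r : ℝ | 0 < r ∧ ENNReal.ofReal h < n r} ⊆ Ioo 0 R := fun x hx => by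
      refine ⟨hx.1, ?_⟩
      by_contra! hRx
      exact absurd hx.2 (not_lt.2 ((hn hRx).trans hR))
    exact measure_ne_top_of_subset hsub (by simp)
  rw [layerRadius, ← ENNReal.ofReal_le_iff_le_toReal htop]
  calc ENNReal.ofReal r = volume (Ioo 0 r) := by simp
    _ ≤ volume {r : ℝ | 0 < r ∧ ENNReal.ofReal h < n r} :=
        measure_mono fun x hx => ⟨hx.1, hlt.trans_le (hn hx.2.le)⟩

theorem lt_of_lt_layerRadius {n : ℝ → ℝ≥0∞} (hn : Antitone n) {h r : ℝ} (hr : 0 ≤ r)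
    (hlt : r < layerRadius n h) : ENNReal.ofReal h < n r := by
  by_contra! hle
  refine hlt.not_ge (ENNReal.toReal_le_of_le_ofReal hr ?_)
  calc volume {x : ℝ | 0 < x ∧ ENNReal.ofReal h < n x} ≤ volume (Ioo 0 r) := by
        refine measure_mono fun x hx => ⟨hx.1, ?_⟩
        by_contra! hrx
        exact absurd hx.2 (not_lt.2 ((hn hrx).trans hle))
    _ = ENNReal.ofReal r := by simp

section

variable {E E' : Type*} [NormedAddCommGroup E] [InnerProductSpace ℝ E] [FiniteDimensional ℝ E]
  [MeasurableSpace E] [BorelSpace E] [NormedAddCommGroup E'] [InnerProductSpace ℝ E']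
  [FiniteDimensional ℝ E'] [MeasurableSpace E'] [BorelSpace E']

/-- Layer-cake formula for a radially decreasing density: `n ‖y‖ dy` is a mixture of Lebesgue
measure on centred balls. The superlevel sets are balls only up to a sphere, which is a null set. -/
theorem setLIntegral_layerRadius [Nontrivial E] {n : ℝ → ℝ≥0∞} (hn : Antitone n)
    (hn0 : ∀ ε : ℝ, 0 < ε → ∃ r, n r ≤ ENNReal.ofReal ε) {F : E → ℝ≥0∞} (hF : Measurable F) :
    ∫⁻ h in Ioi (0 : ℝ), ∫⁻ y in Metric.ball (0 : E) (layerRadius n h), F y =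
      ∫⁻ y, n ‖y‖ * F y := by
  have hball : ∀ h ∈ Ioi (0 : ℝ), ∫⁻ y in Metric.ball (0 : E) (layerRadius n h), F y =
      ∫⁻ y : E, {h : ℝ | ENNReal.ofReal h < n ‖y‖}.indicator 1 h * F y := by
    intro h hh
    rw [← lintegral_indicator measurableSet_ball]
    have hsphere : ∀ᵐ y : E, y ∉ Metric.sphere (0 : E) (layerRadius n h) :=
      measure_eq_zero_iff_ae_notMem.1 (Measure.addHaar_sphere volume _ _)
    refine lintegral_congr_ae ?_
    filter_upwards [hsphere] with y hy
    rw [mem_sphere_zero_iff_norm] at hy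
    by_cases hlt : ENNReal.ofReal h < n ‖y‖
    · have h1 := lt_of_le_of_ne (le_layerRadius hn hn0 hh hlt) hy
      rw [indicator_of_mem (mem_ball_zero_iff.2 h1),
        indicator_of_mem (s := {h : ℝ | ENNReal.ofReal h < n ‖y‖}) hlt, Pi.one_apply,
        one_mul]
    · have h1 : y ∉ Metric.ball (0 : E) (layerRadius n h) := fun h1 =>
        hlt (lt_of_lt_layerRadius hn (norm_nonneg y) (mem_ball_zero_iff.1 h1))
      rw [indicator_of_notMem h1,
        indicator_of_notMem (s := {h : ℝ | ENNReal.ofReal h < n ‖y‖}) hlt, zero_mul]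
  have hset : MeasurableSet {p : ℝ × E | ENNReal.ofReal p.1 < n ‖p.2‖} :=
    measurableSet_lt (by fun_prop) (hn.measurable.comp (by fun_prop))
  have hJ : Measurable (Function.uncurry fun (h : ℝ) (y : E) =>
      {h : ℝ | ENNReal.ofReal h < n ‖y‖}.indicator (1 : ℝ → ℝ≥0∞) h * F y) :=
    (measurable_one.indicator hset).mul (hF.comp measurable_snd)
  rw [setLIntegral_congr_fun measurableSet_Ioi hball, lintegral_lintegral_swap hJ.aemeasurable]
  congr 1 with y
  have hset' : MeasurableSet {h : ℝ | ENNReal.ofReal h < n ‖y‖} :=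
    measurableSet_lt (by fun_prop) (by fun_prop)
  rw [lintegral_mul_const _ (measurable_one.indicator hset'), lintegral_indicator_one hset',
    Measure.restrict_apply hset', inter_comm, volume_inter_ofReal_lt]

/-- A radially decreasing measure on `E` is the projection of a rotation invariant measure on
`E × ℂ`. By the layer-cake formula it is a mixture of uniform measures on balls, and by the hat-box
theorem each of these is the projection of a multiple of the uniform measure on the sphere of the
same radius; no differentiability of `n` is needed. -/
theorem exists_measure_map_fst_eq_withDensity [Nontrivial E] (L : E' ≃ₗᵢ[ℝ] WithLp 2 (E × ℂ))
    {n : ℝ → ℝ≥0∞} (hn : Antitone n) (hn0 : ∀ ε : ℝ, 0 < ε → ∃ r, n r ≤ ENNReal.ofReal ε) :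
    ∃ N : Measure E', SFinite N ∧ (∀ U : E' ≃ₗᵢ[ℝ] E', N.map U = N) ∧
      N.map (fun x => (L x).fst) = (volume : Measure E).withDensity fun y => n ‖y‖ := by
  let s := layerRadius n
  let k := Module.finrank ℝ E
  have hs : Measurable s := measurable_layerRadius n
  have hk : k ≠ 0 := Module.finrank_pos.ne'
  let w : ℝ → ℝ≥0∞ := fun h => ENNReal.ofReal (s h ^ k / (2 * Real.pi))
  have hw : Measurable w := by fun_prop
  let Q : Measure (ℝ × E') :=
    ((volume.restrict (Ioi (0 : ℝ))).withDensity w).prod (sphereMeasure E')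
  let g : ℝ × E' → E' := fun p => s p.1 • p.2
  have hg : Measurable g := by fun_prop
  have hπ : Measurable fun x : E' => (L x).fst :=
    (WithLp.measurable_ofLp 2 (E × ℂ)).fst.comp L.continuous.measurable
  refine ⟨Q.map g, inferInstance, fun U => ?_, ?_⟩
  · have hU : Measurable U := U.continuous.measurable
    have hQU : Q.map (Prod.map id U) = Q := by
      rw [← Measure.map_prod_map _ _ measurable_id hU, Measure.map_id,
        sphereMeasure_map_linearIsometryEquiv]
    calc (Q.map g).map U = (Q.map (Prod.map id U)).map g := by
          rw [Measure.map_map hU hg, Measure.map_map hg (measurable_id.prodMap hU)]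
          congr 1
          ext p
          simp [g]
      _ = Q.map g := by rw [hQU]
  · refine Measure.ext_of_lintegral _ fun F hF => ?_
    have hFL : Measurable fun x : E' => F (L x).fst := hF.comp hπ
    have hFg : Measurable fun p : ℝ × E' => F (L (g p)).fst := hFL.comp hg
    have hnm : Measurable fun y : E => n ‖y‖ := hn.measurable.comp measurable_norm
    rw [lintegral_map hF hπ, lintegral_map hFL hg, lintegral_prod _ hFg.aemeasurable,
      lintegral_withDensity_eq_lintegral_mul _ hw hFg.lintegral_prod_right',
      lintegral_withDensity_eq_lintegral_mul _ hnm hF]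
    refine Eq.trans ?_ (setLIntegral_layerRadius hn hn0 hF)
    refine setLIntegral_congr_fun measurableSet_Ioi fun h _ => ?_
    have hFs : Measurable fun y : E => F (s h • y) := hF.comp (by fun_prop)
    change w h * ∫⁻ ω, F (L (s h • ω)).fst ∂(sphereMeasure E') =
      ∫⁻ y in Metric.ball (0 : E) (s h), F y
    simp_rw [map_smul, WithLp.smul_fst]
    rw [lintegral_sphereMeasure_fst L hFs, ← mul_assoc,
      ← ENNReal.ofReal_mul (by have := layerRadius_nonneg n h; positivity),
      div_mul_cancel₀ _ (by positivity)]
    rcases (layerRadius_nonneg n h).eq_or_lt with h0 | h0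
    · have h0' : s h = 0 := h0.symm
      simp [h0', hk]
    · exact (setLIntegral_ball_eq_pow_mul hF h0).symm

end

/-! ### Exponents of rotation invariant lifts -/

theorem exists_linearIsometryEquiv_apply_eq {V : Type*} [NormedAddCommGroup V]
    [InnerProductSpace ℝ V] {v w : V} (h : ‖v‖ = ‖w‖) : ∃ U : V ≃ₗᵢ[ℝ] V, U v = w :=
  ⟨_, Submodule.reflection_sub h⟩

theorem nonempty_linearIsometryEquiv_prod_complex (d : ℕ) : Nonempty
    (EuclideanSpace ℝ (Fin (d + 2)) ≃ₗᵢ[ℝ] WithLp 2 (EuclideanSpace ℝ (Fin d) × ℂ)) := by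
  have h : Module.finrank ℝ (WithLp 2 (EuclideanSpace ℝ (Fin d) × ℂ)) = d + 2 := by
    rw [(WithLp.linearEquiv 2 ℝ (EuclideanSpace ℝ (Fin d) × ℂ)).finrank_eq, Module.finrank_prod,
      Complex.finrank_real_complex, finrank_euclideanSpace_fin]
  exact ⟨((stdOrthonormalBasis ℝ _).reindex (finCongr h)).repr.symm⟩

section

variable {E E' : Type*} [NormedAddCommGroup E] [InnerProductSpace ℝ E]
  [NormedAddCommGroup E'] [InnerProductSpace ℝ E']

theorem inner_symm_toLp_fst (L : E' ≃ₗᵢ[ℝ] WithLp 2 (E × ℂ)) (x : E') (ξ : E) :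
    inner ℝ x (L.symm (WithLp.toLp 2 (ξ, 0))) = inner ℝ (L x).fst ξ := by
  rw [← L.inner_map_map, L.apply_symm_apply, WithLp.prod_inner_apply]
  simp

theorem norm_symm_toLp_fst (L : E' ≃ₗᵢ[ℝ] WithLp 2 (E × ℂ)) (ξ : E) :
    ‖L.symm (WithLp.toLp 2 (ξ, 0))‖ = ‖ξ‖ := by
  rw [L.symm.norm_map, WithLp.prod_norm_eq_of_L2]
  simp

variable [MeasurableSpace E] [BorelSpace E] [MeasurableSpace E'] [BorelSpace E']

theorem measurable_fst_linearIsometryEquiv (L : E' ≃ₗᵢ[ℝ] WithLp 2 (E × ℂ)) :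
    Measurable fun x => (L x).fst := by
  have : Continuous fun x => (L x).fst := by fun_prop
  exact this.measurable

/-- If a rotation invariant measure on `E × ℂ` projects to `N`, then its one-dimensional marginals
in all directions coincide with those of `N`. -/
theorem map_inner_eq_of_map_fst (L : E' ≃ₗᵢ[ℝ] WithLp 2 (E × ℂ)) {N' : Measure E'}
    (hU : ∀ U : E' ≃ₗᵢ[ℝ] E', N'.map U = N') {N : Measure E}
    (hN : N'.map (fun x => (L x).fst) = N) {ξ : E'} {u : E} (h : ‖ξ‖ = ‖u‖) :
    N'.map (fun x => inner ℝ x ξ) = N.map (fun y => inner ℝ y u) := by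
  obtain ⟨U, hUξ⟩ := exists_linearIsometryEquiv_apply_eq (h.trans (norm_symm_toLp_fst L u).symm)
  have hUm : Measurable U := U.continuous.measurable
  rw [← hN, Measure.map_map (Continuous.measurable (by fun_prop))
    (measurable_fst_linearIsometryEquiv L)]
  conv_rhs => rw [← hU U]
  have h1 : Measurable ((fun y : E => inner ℝ y u) ∘ fun x : E' => (L x).fst) :=
    Continuous.measurable (by fun_prop)
  rw [Measure.map_map h1 hUm]
  congr 1
  ext x
  simp only [Function.comp_apply]
  rw [← inner_symm_toLp_fst, ← hUξ, U.inner_map_map]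

theorem integral_one_sub_cos_inner_of_map_fst (L : E' ≃ₗᵢ[ℝ] WithLp 2 (E × ℂ)) {N' : Measure E'}
    (hU : ∀ U : E' ≃ₗᵢ[ℝ] E', N'.map U = N') {N : Measure E}
    (hN : N'.map (fun x => (L x).fst) = N) {ξ : E'} {u : E} (h : ‖ξ‖ = ‖u‖) :
    ∫ x, (1 - Real.cos (inner ℝ x ξ)) ∂N' = ∫ y, (1 - Real.cos (inner ℝ y u)) ∂N := by
  have hc : ∀ ν : Measure ℝ, AEStronglyMeasurable (fun s => 1 - Real.cos s) ν := fun ν =>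
    Continuous.aestronglyMeasurable (by fun_prop)
  rw [← integral_map (φ := fun x : E' => inner ℝ x ξ)
    (Continuous.measurable (by fun_prop)).aemeasurable (hc _),
    ← integral_map (φ := fun y : E => inner ℝ y u)
    (Continuous.measurable (by fun_prop)).aemeasurable (hc _), map_inner_eq_of_map_fst L hU hN h]

/-- A rotation invariant lift of a Lévy measure satisfies the integrability condition of a Lévy
measure, since that condition may be checked on coordinates. -/
theorem lintegral_min_norm_sq_one_lt_top_of_map_fst [FiniteDimensional ℝ E'] [Nontrivial E]
    (L : E' ≃ₗᵢ[ℝ] WithLp 2 (E × ℂ)) {N' : Measure E'}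
    (hU : ∀ U : E' ≃ₗᵢ[ℝ] E', N'.map U = N') {N : Measure E}
    (hN : N'.map (fun x => (L x).fst) = N)
    (hfin : ∫⁻ y, ENNReal.ofReal (min (‖y‖ ^ 2) 1) ∂N < ∞) :
    ∫⁻ x, ENNReal.ofReal (min (‖x‖ ^ 2) 1) ∂N' < ∞ := by
  obtain ⟨u, hu⟩ := exists_norm_eq E zero_le_one
  let e := stdOrthonormalBasis ℝ E'
  have hle : ∀ x : E', ENNReal.ofReal (min (‖x‖ ^ 2) 1) ≤
      ∑ i, ENNReal.ofReal (min ((inner ℝ x (e i)) ^ 2) 1) := by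
    intro x
    rw [← ENNReal.ofReal_sum_of_nonneg fun i _ => by positivity]
    refine ENNReal.ofReal_le_ofReal ?_
    by_cases h : ∃ i, 1 ≤ (inner ℝ x (e i)) ^ 2
    · obtain ⟨i, hi⟩ := h
      calc min (‖x‖ ^ 2) 1 ≤ 1 := min_le_right _ _
        _ = min ((inner ℝ x (e i)) ^ 2) 1 := (min_eq_right hi).symm
        _ ≤ _ := Finset.single_le_sum (f := fun i => min ((inner ℝ x (e i)) ^ 2) 1)
          (fun i _ => by positivity) (Finset.mem_univ i)
    · push Not at h
      rw [Finset.sum_congr rfl fun i _ => min_eq_left (h i).le, e.sum_sq_inner_left]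
      exact min_le_left _ _
  have hone : ∀ i, ∫⁻ x, ENNReal.ofReal (min ((inner ℝ x (e i)) ^ 2) 1) ∂N' < ∞ := by
    intro i
    have hm : Measurable fun s : ℝ => ENNReal.ofReal (min (s ^ 2) 1) := by fun_prop
    have hc : Measurable fun x : E' => inner ℝ x (e i) := Continuous.measurable (by fun_prop)
    have hc' : Measurable fun y : E => inner ℝ y u := Continuous.measurable (by fun_prop)
    rw [← lintegral_map hm hc,
      map_inner_eq_of_map_fst L hU hN ((e.orthonormal.1 i).trans hu.symm), lintegral_map hm hc']
    refine (lintegral_mono fun y => ENNReal.ofReal_le_ofReal (min_le_min_right _ ?_)).trans_lt hfin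
    rw [← sq_abs]
    refine pow_le_pow_left₀ (abs_nonneg _) ?_ 2
    simpa [hu] using abs_real_inner_le_norm y u
  calc ∫⁻ x, ENNReal.ofReal (min (‖x‖ ^ 2) 1) ∂N'
      ≤ ∫⁻ x, ∑ i, ENNReal.ofReal (min ((inner ℝ x (e i)) ^ 2) 1) ∂N' := lintegral_mono hle
    _ = ∑ i, ∫⁻ x, ENNReal.ofReal (min ((inner ℝ x (e i)) ^ 2) 1) ∂N' :=
        lintegral_finsetSum _ fun i _ => (Continuous.measurable (by fun_prop)).ennreal_ofReal
    _ < ∞ := ENNReal.sum_lt_top.2 fun i _ => hone i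

theorem norm_exp_mul_I_sub_one_sub_le (u : ℝ) :
    ‖Complex.exp ((u : ℂ) * Complex.I) - 1 - u * Complex.I‖ ≤ 3 * u ^ 2 := by
  have hu : ‖(u : ℂ) * Complex.I‖ = |u| := by simp
  rcases le_or_gt |u| 1 with h | h
  · calc _ ≤ ‖(u : ℂ) * Complex.I‖ ^ 2 := Complex.norm_exp_sub_one_sub_id_le (hu.trans_le h)
      _ = u ^ 2 := by rw [hu, sq_abs]
      _ ≤ 3 * u ^ 2 := by nlinarith [sq_nonneg u]
  · calc _ ≤ ‖Complex.exp ((u : ℂ) * Complex.I)‖ + ‖(1 : ℂ)‖ + ‖(u : ℂ) * Complex.I‖ :=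
          (norm_sub_le _ _).trans (by gcongr; exact norm_sub_le _ _)
      _ = 2 + |u| := by rw [hu, Complex.norm_exp_ofReal_mul_I, norm_one]; norm_num
      _ ≤ 3 * u ^ 2 := by rw [← sq_abs]; nlinarith

variable [SecondCountableTopology E]

/-- The Lévy–Khintchine formula for a real exponent: comparing absolute values removes the drift and
the compensating terms. -/
theorem IsPureJumpWithLevyMeasure.exponent_eq {Ω : Type*} [MeasurableSpace Ω] {P : Measure Ω}
    {X : ℝ≥0 → Ω → E} {N : Measure E} (hX : IsPureJumpWithLevyMeasure P X N) {φ : E → ℝ}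
    (hφ : HasCharExponent P X φ) (ξ : E) : φ ξ = ∫ x, (1 - Real.cos (inner ℝ x ξ)) ∂N := by
  obtain ⟨b, hb⟩ := hX
  have hfin := hb.levyMeasure.lintegral_lt_top
  set K : E → ℂ := fun x => Complex.exp (((inner ℝ x ξ : ℝ) : ℂ) * Complex.I) - 1
    - (Metric.closedBall (0 : E) 1).indicator
      (fun y => ((inner ℝ y ξ : ℝ) : ℂ) * Complex.I) x with hK
  have hmin : Integrable (fun x : E => min (‖x‖ ^ 2) 1) N := by
    refine ⟨by fun_prop, ?_⟩
    rwa [hasFiniteIntegral_iff_ofReal (Eventually.of_forall fun x => by positivity)]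
  have hKm : Measurable K := by
    refine Measurable.sub (by fun_prop) (Measurable.indicator (by fun_prop)
      Metric.isClosed_closedBall.measurableSet)
  have hKint : Integrable K N := by
    refine (hmin.const_mul (3 * ‖ξ‖ ^ 2 + 2)).mono' hKm.aestronglyMeasurable
      (Eventually.of_forall fun x => ?_)
    by_cases hx : x ∈ Metric.closedBall (0 : E) 1
    · have hx1 : ‖x‖ ≤ 1 := mem_closedBall_zero_iff.1 hx
      simp only [hK, indicator_of_mem hx]
      rw [min_eq_left (pow_le_one₀ (norm_nonneg x) hx1)]
      refine (norm_exp_mul_I_sub_one_sub_le _).trans ?_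
      have h2 : (inner ℝ x ξ) ^ 2 ≤ (‖x‖ * ‖ξ‖) ^ 2 := by
        rw [← sq_abs]
        exact pow_le_pow_left₀ (abs_nonneg _) (abs_real_inner_le_norm x ξ) 2
      nlinarith [sq_nonneg ‖x‖]
    · have hx1 : 1 < ‖x‖ := by simpa using hx
      simp only [hK, indicator_of_notMem hx, sub_zero]
      rw [min_eq_right (one_le_pow₀ hx1.le), mul_one]
      refine (norm_sub_le _ _).trans ?_
      rw [Complex.norm_exp_ofReal_mul_I, norm_one]
      nlinarith [sq_nonneg ‖ξ‖]
  have hre : (∫ x, K x ∂N).re = -∫ x, (1 - Real.cos (inner ℝ x ξ)) ∂N := by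
    have := integral_re hKint
    simp only [RCLike.re_to_complex] at this
    rw [← this, ← integral_neg]
    congr 1 with x
    by_cases hx : x ∈ Metric.closedBall (0 : E) 1
    · simp [hK, indicator_of_mem hx, -Metric.mem_closedBall, Complex.exp_ofReal_mul_I_re]
    · simp [hK, indicator_of_notMem hx, -Metric.mem_closedBall, Complex.exp_ofReal_mul_I_re]
  have h := congrArg norm ((hφ 1 ξ).symm.trans (hb.charFun_eq 1 ξ))
  rw [Complex.norm_exp, Complex.norm_exp, Real.exp_eq_exp] at h
  simp only [NNReal.coe_one, one_mul, Complex.ofReal_re, Complex.ofReal_one,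
    zero_apply, inner_zero_left, Complex.ofReal_zero, mul_zero, zero_add,
    Complex.add_re] at h
  change -φ ξ = (((inner ℝ b ξ : ℝ) : ℂ) * Complex.I).re + (∫ x, K x ∂N).re at h
  rw [hre] at h
  simp at h
  linarith

end

/-! ### The process in two more dimensions and its radial density -/

/-- The profile `ν` on `(0, ∞)`, extended by `∞` to an antitone function on `ℝ`, which in particular
is measurable. -/
noncomputable def extendedProfile (ν : ℝ → ℝ) (r : ℝ) : ℝ≥0∞ :=
  if 0 < r then ENNReal.ofReal (ν r) else ∞

theorem antitone_extendedProfile {ν : ℝ → ℝ} (hν : AntitoneOn ν (Ioi 0)) :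
    Antitone (extendedProfile ν) := by
  intro r r' hr
  rcases le_or_gt r 0 with h | h
  · simp [extendedProfile, h.not_gt]
  · simp only [extendedProfile, h, h.trans_le hr, if_true]
    exact ENNReal.ofReal_le_ofReal (hν h (h.trans_le hr) hr)

/-- The profile of a Lévy measure takes arbitrarily small values, as the measure of `{1 < ‖x‖}` is
finite. -/
theorem exists_extendedProfile_le {E : Type*} [NormedAddCommGroup E] [InnerProductSpace ℝ E]
    [FiniteDimensional ℝ E] [MeasurableSpace E] [BorelSpace E] [Nontrivial E] {n : ℝ → ℝ≥0∞}
    (hfin : ∫⁻ y, ENNReal.ofReal (min (‖y‖ ^ 2) 1)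
      ∂((volume : Measure E).withDensity fun y => n ‖y‖) < ∞) {ε : ℝ} (hε : 0 < ε) :
    ∃ r, n r ≤ ENNReal.ofReal ε := by
  by_contra! h
  have hS : MeasurableSet {x : E | 1 < ‖x‖} := measurableSet_lt (by fun_prop) (by fun_prop)
  have hcompl : {x : E | 1 < ‖x‖} = (Metric.closedBall (0 : E) 1)ᶜ := by
    ext x
    simp
  have hvol : volume {x : E | 1 < ‖x‖} = ∞ := by
    have : NoncompactSpace E := NormedSpace.noncompactSpace ℝ E
    rw [hcompl, measure_compl Metric.isClosed_closedBall.measurableSet measure_closedBall_lt_top.ne,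
      measure_univ_of_isAddLeftInvariant, ENNReal.top_sub measure_closedBall_lt_top.ne]
  refine (measure_lt_norm_lt_top hfin one_pos).ne (top_unique ?_)
  rw [withDensity_apply _ hS]
  calc ∞ = ENNReal.ofReal ε * volume {x : E | 1 < ‖x‖} := by
        rw [hvol, ENNReal.mul_top (by simpa using hε)]
    _ = ∫⁻ _ in {x : E | 1 < ‖x‖}, ENNReal.ofReal ε := (setLIntegral_const _ _).symm
    _ ≤ ∫⁻ x in {x : E | 1 < ‖x‖}, n ‖x‖ := lintegral_mono fun x => (h _).le

theorem radialMeasure_eq_withDensity_extendedProfile {d : ℕ} (hd : 1 ≤ d) (ν : ℝ → ℝ) :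
    radialMeasure d ν = volume.withDensity fun x => extendedProfile ν ‖x‖ := by
  have : Nontrivial (EuclideanSpace ℝ (Fin d)) :=
    Module.nontrivial_of_finrank_pos (R := ℝ) (by rw [finrank_euclideanSpace_fin]; omega)
  refine withDensity_congr_ae ?_
  filter_upwards [measure_eq_zero_iff_ae_notMem.1
    (measure_singleton (μ := (volume : Measure (EuclideanSpace ℝ (Fin d)))) 0)] with x hx
  have : x ≠ 0 := hx
  simp [extendedProfile, this]

/-- The function `ψ(|ξ|)` remains the exponent of a Lévy process two dimensions higher: its Lévy
measure is the rotation invariant lift of the one given. -/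
theorem exists_isLevyProcess_of_isPureJumpWithLevyMeasure {Ω : Type*} [MeasurableSpace Ω]
    {P : Measure Ω} {d : ℕ} (hd : 1 ≤ d) {X : ℝ≥0 → Ω → EuclideanSpace ℝ (Fin d)} {ψ ν : ℝ → ℝ}
    (hν : AntitoneOn ν (Ioi 0)) (hjump : IsPureJumpWithLevyMeasure P X (radialMeasure d ν))
    (hψ : HasCharExponent P X fun ξ => ψ ‖ξ‖) :
    ∃ (Ω' : Type) (_ : MeasurableSpace Ω') (P' : Measure Ω') (_ : IsProbabilityMeasure P')
      (X' : ℝ≥0 → Ω' → EuclideanSpace ℝ (Fin (d + 2))),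
      IsLevyProcess P' X' ∧ HasCharExponent P' X' fun ξ => ψ ‖ξ‖ := by
  have : Nontrivial (EuclideanSpace ℝ (Fin d)) :=
    Module.nontrivial_of_finrank_pos (R := ℝ) (by rw [finrank_euclideanSpace_fin]; omega)
  obtain ⟨L⟩ := nonempty_linearIsometryEquiv_prod_complex d
  have hfin : ∫⁻ y, ENNReal.ofReal (min (‖y‖ ^ 2) 1) ∂(radialMeasure d ν) < ∞ := by
    obtain ⟨b, hb⟩ := hjump
    exact hb.levyMeasure.lintegral_lt_top
  have hn := antitone_extendedProfile hν
  obtain ⟨N', hN', hU, hmap⟩ := exists_measure_map_fst_eq_withDensity L hn fun ε hε =>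
    exists_extendedProfile_le (E := EuclideanSpace ℝ (Fin d))
      (by rwa [← radialMeasure_eq_withDensity_extendedProfile hd]) hε
  rw [← radialMeasure_eq_withDensity_extendedProfile hd] at hmap
  obtain ⟨Ω', mΩ', P', hP', X', hX', hX'ψ⟩ := exists_isLevyProcess_hasCharExponent N'
    (hU (LinearIsometryEquiv.neg ℝ)) (lintegral_min_norm_sq_one_lt_top_of_map_fst L hU hmap hfin)
  refine ⟨Ω', mΩ', P', hP', X', hX', fun t ξ => ?_⟩
  obtain ⟨u, hu⟩ := exists_norm_eq (EuclideanSpace ℝ (Fin d)) (norm_nonneg ξ)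
  rw [hX'ψ t ξ]
  beta_reduce
  rw [integral_one_sub_cos_inner_of_map_fst L hU hmap hu.symm,
    ← hjump.exponent_eq hψ u, hu]

section

variable {V : Type*} [NormedAddCommGroup V] [InnerProductSpace ℝ V] [FiniteDimensional ℝ V]
  [MeasurableSpace V] [BorelSpace V]

/-- If `ψ` grows faster than the logarithm, `exp (-t ψ(|ξ|))` decays faster than any power. -/
theorem integrable_charFun_of_tendsto_div_log {ψ : ℝ → ℝ}
    (hψ : Tendsto (fun ρ : ℝ => ψ ρ / Real.log ρ) atTop atTop) {t : ℝ} (ht : 0 < t)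
    {μ : Measure V} [IsProbabilityMeasure μ]
    (hμ : ∀ ξ, charFun μ ξ = Complex.exp ((-(t * ψ ‖ξ‖) : ℝ) : ℂ)) :
    Integrable (charFun μ) := by
  set m : ℝ := Module.finrank ℝ V + 1
  have hm : 0 ≤ m := by positivity
  obtain ⟨R, hR⟩ :=
    ((hψ.eventually_ge_atTop (m / t)).and (eventually_gt_atTop 1)).exists_forall_of_atTop
  have hR1 : 1 < R := (hR R le_rfl).2
  refine ((integrable_one_add_norm (E := V) (μ := volume) (r := m) (by simp [m])).const_mul
    ((1 + R) ^ m)).mono' continuous_charFun.aestronglyMeasurable (Eventually.of_forall fun ξ => ?_)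
  have h1 : 0 < 1 + ‖ξ‖ := by positivity
  rw [Real.rpow_neg h1.le, ← div_eq_mul_inv, ← Real.div_rpow (by linarith) h1.le]
  rcases le_total ‖ξ‖ R with h | h
  · refine (norm_charFun_le_one ξ).trans (Real.one_le_rpow ?_ hm)
    rw [one_le_div h1]
    linarith
  · obtain ⟨h2, h3⟩ := hR _ h
    have hlog : 0 < Real.log ‖ξ‖ := Real.log_pos h3
    rw [hμ, Complex.norm_exp_ofReal]
    have h4 : m * Real.log ‖ξ‖ ≤ t * ψ ‖ξ‖ := by
      rw [le_div_iff₀ hlog, div_mul_eq_mul_div, div_le_iff₀ ht] at h2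
      linarith
    calc Real.exp (-(t * ψ ‖ξ‖)) ≤ Real.exp (-(m * Real.log ‖ξ‖)) := by gcongr
      _ = (‖ξ‖⁻¹) ^ m := by
        rw [Real.rpow_def_of_pos (by positivity), Real.log_inv]
        ring_nf
      _ ≤ ((1 + R) / (1 + ‖ξ‖)) ^ m := by
        refine Real.rpow_le_rpow (by positivity) ?_ hm
        rw [inv_le_iff_one_le_mul₀ (by positivity), div_mul_eq_mul_div, one_le_div h1]
        nlinarith

theorem map_linearIsometryEquiv_of_charFun {μ : Measure V} [IsProbabilityMeasure μ] {φ : ℝ → ℂ}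
    (hμ : ∀ ξ, charFun μ ξ = φ ‖ξ‖) (U : V ≃ₗᵢ[ℝ] V) : μ.map U = μ := by
  have hUm : Measurable U := U.continuous.measurable
  refine Measure.ext_of_charFun ?_
  ext ξ
  have : charFun (μ.map U) ξ = charFun μ (U.symm ξ) := by
    rw [charFun_apply, charFun_apply, integral_map hUm.aemeasurable
      (Continuous.aestronglyMeasurable (by fun_prop))]
    congr 1 with x
    rw [← U.inner_map_map x, U.apply_symm_apply]
  rw [this, hμ, hμ, U.symm.norm_map]

/-- A radial integrable characteristic function yields a radial continuous density: the continuous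
density is invariant under isometries almost everywhere, hence everywhere. -/
theorem exists_continuous_radial_density [Nontrivial V] {μ : Measure V} [IsProbabilityMeasure μ]
    {φ : ℝ → ℂ} (hμ : ∀ ξ, charFun μ ξ = φ ‖ξ‖) (hint : Integrable (charFun μ)) :
    ∃ q : ℝ → ℝ, Continuous q ∧ (∀ r, 0 ≤ q r) ∧
      μ = volume.withDensity fun x => ENNReal.ofReal (q ‖x‖) := by
  obtain ⟨f, hf, hf0, hfμ⟩ := exists_continuous_density_of_integrable_charFun μ hint
  have hinv : ∀ (U : V ≃ₗᵢ[ℝ] V) (x : V), f (U x) = f x := by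
    intro U
    have hUe := U.toHomeomorph.measurableEmbedding
    have hcont : Continuous fun x => ENNReal.ofReal (f x) :=
      ENNReal.continuous_ofReal.comp hf
    have hcontU : Continuous fun x => ENNReal.ofReal (f (U x)) := hcont.comp U.continuous
    have hd : volume.withDensity (fun x => ENNReal.ofReal (f (U x))) =
        volume.withDensity (fun x => ENNReal.ofReal (f x)) := by
      ext A hA
      have hB : MeasurableSet (U.symm ⁻¹' A) := U.symm.continuous.measurable hA
      have hAB : U ⁻¹' (U.symm ⁻¹' A) = A := by ext; simp
      calc volume.withDensity (fun x => ENNReal.ofReal (f (U x))) A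
          = ∫⁻ x in U ⁻¹' (U.symm ⁻¹' A), ENNReal.ofReal (f (U x)) := by
            rw [hAB, withDensity_apply _ hA]
        _ = ∫⁻ x in U.symm ⁻¹' A, ENNReal.ofReal (f x) :=
            U.measurePreserving.setLIntegral_comp_preimage_emb hUe
              (fun x => ENNReal.ofReal (f x)) _
        _ = μ (U.symm ⁻¹' A) := by rw [hfμ, withDensity_apply _ hB]
        _ = μ A := by
            conv_rhs => rw [← map_linearIsometryEquiv_of_charFun hμ U.symm]
            rw [Measure.map_apply U.symm.continuous.measurable hA]
        _ = _ := by rw [hfμ]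
    have hae := (withDensity_eq_iff_of_sigmaFinite hcontU.measurable.aemeasurable
      hcont.measurable.aemeasurable).1 hd
    intro x
    have := congrFun ((Continuous.ae_eq_iff_eq volume hcontU hcont).1 hae) x
    exact (ENNReal.ofReal_eq_ofReal_iff (hf0 _) (hf0 _)).1 this
  obtain ⟨u, hu⟩ := exists_norm_eq V zero_le_one
  refine ⟨fun r => f (r • u), hf.comp (by fun_prop), fun r => hf0 _, ?_⟩
  have hrad : ∀ x, f (‖x‖ • u) = f x := fun x => by
    obtain ⟨U, hU⟩ := exists_linearIsometryEquiv_apply_eq (v := x) (w := ‖x‖ • u)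
      (by simp [norm_smul, hu])
    rw [← hU, hinv]
  simp_rw [hrad]
  exact hfμ

/-- Radial densities that are continuous away from the origin are determined by the measure. -/
theorem eqOn_of_withDensity_norm_eq [Nontrivial V] {p₁ p₂ : ℝ → ℝ} (h₁ : ContinuousOn p₁ (Ioi 0))
    (h₂ : ContinuousOn p₂ (Ioi 0)) (h₁0 : ∀ r, 0 < r → 0 ≤ p₁ r) (h₂0 : ∀ r, 0 < r → 0 ≤ p₂ r)
    (h : (volume : Measure V).withDensity (fun x => ENNReal.ofReal (p₁ ‖x‖)) =
      volume.withDensity (fun x => ENNReal.ofReal (p₂ ‖x‖))) : EqOn p₁ p₂ (Ioi 0) := by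
  have hcont : ∀ p : ℝ → ℝ, ContinuousOn p (Ioi 0) →
      ContinuousOn (fun x : V => ENNReal.ofReal (p ‖x‖)) {0}ᶜ := fun p hp =>
    ENNReal.continuous_ofReal.comp_continuousOn
      (hp.comp continuous_norm.continuousOn fun x hx => norm_pos_iff.2 hx)
  have hmeas : ∀ p : ℝ → ℝ, ContinuousOn p (Ioi 0) →
      AEMeasurable (fun x : V => ENNReal.ofReal (p ‖x‖)) := fun p hp => by
    have := (hcont p hp).aemeasurable (μ := volume) (measurableSet_singleton _).compl
    rwa [restrict_compl_singleton] at this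
  have hae := (withDensity_eq_iff_of_sigmaFinite (hmeas p₁ h₁) (hmeas p₂ h₂)).1 h
  have heq := Measure.eqOn_open_of_ae_eq (ae_restrict_of_ae hae) isOpen_compl_singleton
    (hcont p₁ h₁) (hcont p₂ h₂)
  intro r hr
  have hr' : 0 < r := hr
  obtain ⟨x, hx⟩ := exists_norm_eq V hr'.le
  have := heq (show x ∈ ({0}ᶜ : Set V) from norm_pos_iff.1 (hx.symm ▸ hr'))
  simp only [hx] at this
  exact (ENNReal.ofReal_eq_ofReal_iff (h₁0 r hr) (h₂0 r hr)).1 this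

end

/-! ### Projection of radial densities -/

section

variable {E E' : Type*} [NormedAddCommGroup E] [InnerProductSpace ℝ E]
  [MeasurableSpace E] [BorelSpace E] [NormedAddCommGroup E'] [InnerProductSpace ℝ E']
  [MeasurableSpace E'] [BorelSpace E']

theorem charFun_map_fst_linearIsometryEquiv (L : E' ≃ₗᵢ[ℝ] WithLp 2 (E × ℂ)) (μ : Measure E')
    (ξ : E) : charFun (μ.map fun x => (L x).fst) ξ =
      charFun μ (L.symm (WithLp.toLp 2 (ξ, 0))) := by
  rw [charFun_apply, charFun_apply,
    integral_map (measurable_fst_linearIsometryEquiv L).aemeasurable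
      (Continuous.aestronglyMeasurable (by fun_prop))]
  simp_rw [inner_symm_toLp_fst]

variable [FiniteDimensional ℝ E] [FiniteDimensional ℝ E']

theorem measurable_setLIntegral_Ioi (g : ℝ → ℝ≥0∞) : Measurable fun r => ∫⁻ v in Ioi r, g v :=
  Antitone.measurable fun _ _ h => lintegral_mono_set (Ioi_subset_Ioi h)

/-- The projection to `E` of a radial measure on `E × ℂ` is radial, with a density that is an
explicit one-dimensional integral. -/
theorem map_fst_withDensity_norm (L : E' ≃ₗᵢ[ℝ] WithLp 2 (E × ℂ)) {g : ℝ → ℝ≥0∞}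
    (hg : Measurable g) :
    ((volume : Measure E').withDensity fun x => g ‖x‖).map (fun x => (L x).fst) =
      volume.withDensity fun y =>
        ENNReal.ofReal (2 * Real.pi) * ∫⁻ v in Ioi ‖y‖, ENNReal.ofReal v * g v := by
  have hL := measurable_fst_linearIsometryEquiv L
  refine Measure.ext_of_lintegral _ fun F hF => ?_
  have hFL : Measurable fun x : E' => F (L x).fst := hF.comp hL
  have hgn : Measurable fun x : E' => g ‖x‖ := hg.comp measurable_norm
  have hm : Measurable fun y : E =>
      ENNReal.ofReal (2 * Real.pi) * ∫⁻ v in Ioi ‖y‖, ENNReal.ofReal v * g v :=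
    ((measurable_setLIntegral_Ioi _).comp measurable_norm).const_mul _
  rw [lintegral_map hF hL, lintegral_withDensity_eq_lintegral_mul _ hgn hFL,
    lintegral_withDensity_eq_lintegral_mul _ hm hF]
  have hH : Measurable (Function.uncurry fun (y : E) (v : ℝ) => g v * F y) :=
    (hg.comp measurable_snd).mul (hF.comp measurable_fst)
  refine (lintegral_fst_norm L hH).trans ?_
  congr 1 with y
  simp_rw [← mul_assoc]
  rw [lintegral_mul_const _ (by fun_prop), Pi.mul_apply, mul_assoc]

theorem hasDerivAt_setIntegral_Ioi {f : ℝ → ℝ} (hf : Continuous f) {r : ℝ}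
    (hint : ∃ a < r, IntegrableOn f (Ioi a)) :
    HasDerivAt (fun s => ∫ v in Ioi s, f v) (-f r) r := by
  obtain ⟨a, har, hint⟩ := hint
  have h1 : HasDerivAt (fun s => (∫ v in Ioi a, f v) - ∫ v in a..s, f v) (-f r) r := by
    simpa using (intervalIntegral.integral_hasDerivAt_right (hf.intervalIntegrable a r)
      hf.stronglyMeasurable.stronglyMeasurableAtFilter hf.continuousAt).const_sub
        (∫ v in Ioi a, f v)
  refine h1.congr_of_eventuallyEq ?_
  filter_upwards [eventually_gt_nhds har] with s hs
  rw [← intervalIntegral.integral_interval_add_Ioi hint (hint.mono_set (Ioi_subset_Ioi hs.le))]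
  ring

/-- The projection of `q(‖x‖) dx` is `p(‖y‖) dy` with `p r = 2 π ∫_r^∞ v q(v) dv`, hence
`p' r = -2 π r q(r)`. At `r = 0` the integral need not converge; at `r > 0` it does, being finite
for almost every `y` and decreasing in `‖y‖`. -/
theorem exists_hasDerivAt_map_fst_eq_withDensity [Nontrivial E] (L : E' ≃ₗᵢ[ℝ] WithLp 2 (E × ℂ))
    {q : ℝ → ℝ} (hq : Continuous q) (hq0 : ∀ r, 0 ≤ q r)
    (hfin : IsFiniteMeasure ((volume : Measure E').withDensity fun x => ENNReal.ofReal (q ‖x‖))) :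
    ∃ p : ℝ → ℝ, (∀ r, 0 < r → 0 ≤ p r) ∧
      (∀ r, 0 < r → HasDerivAt p (-(2 * Real.pi * r * q r)) r) ∧
      ((volume : Measure E').withDensity fun x => ENNReal.ofReal (q ‖x‖)).map
          (fun x => (L x).fst) =
        (volume : Measure E).withDensity fun y => ENNReal.ofReal (p ‖y‖) := by
  have hg : Measurable fun v => ENNReal.ofReal (q v) := hq.measurable.ennreal_ofReal
  have hmap := map_fst_withDensity_norm L hg
  set G : ℝ → ℝ≥0∞ := fun r => ∫⁻ v in Ioi r, ENNReal.ofReal v * ENNReal.ofReal (q v) with hG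
  have hGanti : Antitone G := fun _ _ h => lintegral_mono_set (Ioi_subset_Ioi h)
  have hGtop : ∀ r, 0 < r → G r < ∞ := by
    intro r hr
    have htot : ∫⁻ y : E, ENNReal.ofReal (2 * Real.pi) * G ‖y‖ < ∞ := by
      rw [← setLIntegral_univ, ← withDensity_apply _ MeasurableSet.univ, ← hmap,
        Measure.map_apply (measurable_fst_linearIsometryEquiv L) MeasurableSet.univ]
      exact measure_lt_top _ _
    have hae : ∀ᵐ y : E, ENNReal.ofReal (2 * Real.pi) * G ‖y‖ < ∞ :=
      ae_lt_top (((measurable_setLIntegral_Ioi _).comp measurable_norm).const_mul _) htot.ne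
    -- otherwise the density would be infinite on the ball of radius `r`
    by_contra hr'
    refine (Metric.measure_ball_pos volume (0 : E) hr).ne' (measure_mono_null ?_ hae)
    intro y hy (hlt : ENNReal.ofReal (2 * Real.pi) * G ‖y‖ < ∞)
    have hle : G r ≤ G ‖y‖ := hGanti (mem_ball_zero_iff.1 hy).le
    rw [top_le_iff.1 ((not_lt.1 hr').trans hle), ENNReal.mul_top (by simp [Real.pi_pos])] at hlt
    exact lt_irrefl _ hlt
  have hGofReal : ∀ r, 0 ≤ r → G r = ∫⁻ v in Ioi r, ENNReal.ofReal (v * q v) := fun r hr =>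
    setLIntegral_congr_fun measurableSet_Ioi fun v hv =>
      (ENNReal.ofReal_mul (hr.trans (le_of_lt hv))).symm
  have hcont : Continuous fun v => v * q v := by fun_prop
  have hnonneg : ∀ r, 0 ≤ r → ∀ᵐ v ∂(volume.restrict (Ioi r)), 0 ≤ v * q v := fun r hr => by
    filter_upwards [ae_restrict_mem measurableSet_Ioi] with v hv
    exact mul_nonneg (hr.trans (le_of_lt hv)) (hq0 v)
  have hint : ∀ r, 0 < r → IntegrableOn (fun v => v * q v) (Ioi r) := fun r hr => by
    refine ⟨hcont.aestronglyMeasurable, ?_⟩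
    rw [hasFiniteIntegral_iff_ofReal (hnonneg r hr.le), ← hGofReal r hr.le]
    exact hGtop r hr
  refine ⟨fun r => 2 * Real.pi * ∫ v in Ioi r, v * q v, fun r hr => ?_, fun r hr => ?_, ?_⟩
  · have := integral_nonneg_of_ae (hnonneg r hr.le)
    positivity
  · have := (hasDerivAt_setIntegral_Ioi hcont
      ⟨r / 2, half_lt_self hr, hint _ (half_pos hr)⟩).const_mul (2 * Real.pi)
    rwa [show 2 * Real.pi * -(r * q r) = -(2 * Real.pi * r * q r) by ring] at this
  · rw [hmap]
    refine withDensity_congr_ae ?_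
    filter_upwards [measure_eq_zero_iff_ae_notMem.1
      (measure_singleton (μ := (volume : Measure E)) 0)] with y hy
    have hy' : 0 < ‖y‖ := norm_pos_iff.2 hy
    rw [ENNReal.ofReal_mul (p := 2 * Real.pi) (by positivity),
      ofReal_integral_eq_lintegral_ofReal (hint _ hy')
      (hnonneg _ hy'.le), ← hGofReal _ hy'.le]

end

/-! ### The derivative formula -/

theorem proposition3p1 {Ω : Type*} [MeasurableSpace Ω] (P : Measure Ω) [IsProbabilityMeasure P]
    (d : ℕ) (hd : 1 ≤ d) (X : ℝ≥0 → Ω → EuclideanSpace ℝ (Fin d))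
    (ψ ν : ℝ → ℝ)
    (hX : IsLevyProcess P X)
    (hiso : IsIsotropicProcess P X)
    (hν_nonneg : ∀ r : ℝ, 0 < r → 0 ≤ ν r)
    (hν_anti : AntitoneOn ν (Ioi 0))
    (hjump : IsPureJumpWithLevyMeasure P X (radialMeasure d ν))
    (hψ : HasCharExponent P X (fun ξ => ψ ‖ξ‖))
    (hψ_log : Tendsto (fun ρ : ℝ => ψ ρ / Real.log ρ) atTop atTop) :
    (∃ p : ℝ≥0 → ℝ → ℝ, IsRadialTransitionDensity P X p) ∧
    ∃ (Ω' : Type) (_ : MeasurableSpace Ω') (P' : Measure Ω') (_ : IsProbabilityMeasure P')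
      (X' : ℝ≥0 → Ω' → EuclideanSpace ℝ (Fin (d + 2))) (q : ℝ≥0 → ℝ → ℝ),
      IsLevyProcess P' X' ∧
      HasCharExponent P' X' (fun ξ => ψ ‖ξ‖) ∧
      IsRadialTransitionDensity P' X' q ∧
      ∀ p : ℝ≥0 → ℝ → ℝ, IsRadialTransitionDensity P X p →
        ∀ (t : ℝ≥0) (r : ℝ), 0 < t → 0 < r →
          DifferentiableAt ℝ (p t) r ∧
            q t r = -1 / (2 * Real.pi * r) * deriv (p t) r := by
  have : Nontrivial (EuclideanSpace ℝ (Fin d)) :=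
    Module.nontrivial_of_finrank_pos (R := ℝ) (by rw [finrank_euclideanSpace_fin]; omega)
  obtain ⟨L⟩ := nonempty_linearIsometryEquiv_prod_complex d
  obtain ⟨Ω', mΩ', P', hP', X', hX', hX'ψ⟩ :=
    exists_isLevyProcess_of_isPureJumpWithLevyMeasure hd hν_anti hjump hψ
  have hprob : ∀ t, IsProbabilityMeasure (P.map (X t)) := fun t =>
    Measure.isProbabilityMeasure_map (hX.measurable t).aemeasurable
  have hprob' : ∀ t, IsProbabilityMeasure (P'.map (X' t)) := fun t =>
    Measure.isProbabilityMeasure_map (hX'.measurable t).aemeasurable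
  have hq : ∀ t : ℝ≥0, ∃ q : ℝ → ℝ, 0 < t → Continuous q ∧ (∀ r, 0 ≤ q r) ∧
      P'.map (X' t) = radialMeasure (d + 2) q := fun t => by
    by_cases ht : 0 < t
    · obtain ⟨q, hq⟩ := exists_continuous_radial_density
        (φ := fun r => Complex.exp (((-((t : ℝ) * ψ r) : ℝ) : ℂ))) (hX'ψ t)
        (integrable_charFun_of_tendsto_div_log hψ_log (NNReal.coe_pos.2 ht) (hX'ψ t))
      exact ⟨q, fun _ => hq⟩
    · exact ⟨0, fun h => absurd h ht⟩
  choose q hq using hq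
  have hlaw : ∀ t, (P'.map (X' t)).map (fun x => (L x).fst) = P.map (X t) := fun t => by
    have := Measure.isProbabilityMeasure_map (μ := P'.map (X' t))
      (measurable_fst_linearIsometryEquiv L).aemeasurable
    refine Measure.ext_of_charFun ?_
    ext ξ
    rw [charFun_map_fst_linearIsometryEquiv, hX'ψ t, hψ t]
    beta_reduce
    rw [norm_symm_toLp_fst]
  have hp : ∀ t : ℝ≥0, ∃ p : ℝ → ℝ, 0 < t → (∀ r, 0 < r → 0 ≤ p r) ∧
      (∀ r, 0 < r → HasDerivAt p (-(2 * Real.pi * r * q t r)) r) ∧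
      P.map (X t) = radialMeasure d p := fun t => by
    by_cases ht : 0 < t
    · obtain ⟨hqc, hq0, hqμ⟩ := hq t ht
      obtain ⟨p, hp0, hpd, hpμ⟩ := exists_hasDerivAt_map_fst_eq_withDensity L hqc hq0
        (by have := hprob' t; rw [hqμ] at this; unfold radialMeasure at this; infer_instance)
      refine ⟨p, fun _ => ⟨hp0, hpd, ?_⟩⟩
      rw [← hlaw t, hqμ]
      exact hpμ
    · exact ⟨0, fun h => absurd h ht⟩
  choose p hp using hp
  have hpcont : ∀ t, 0 < t → ContinuousOn (p t) (Ioi 0) := fun t ht r hr =>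
    ((hp t ht).2.1 r hr).continuousAt.continuousWithinAt
  refine ⟨⟨p, fun t ht => ⟨(hp t ht).1, hpcont t ht, (hp t ht).2.2⟩⟩,
    Ω', mΩ', P', hP', X', q, hX', hX'ψ,
    fun t ht => ⟨fun r _ => (hq t ht).2.1 r, (hq t ht).1.continuousOn, (hq t ht).2.2⟩, ?_⟩
  intro p' hp' t r ht hr
  obtain ⟨hp'0, hp'c, hp'μ⟩ := hp' t ht
  have heq : EqOn (p' t) (p t) (Ioi 0) :=
    eqOn_of_withDensity_norm_eq (V := EuclideanSpace ℝ (Fin d)) hp'c (hpcont t ht) hp'0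
      (hp t ht).1 (hp'μ.symm.trans (hp t ht).2.2)
  have hderiv : HasDerivAt (p' t) (-(2 * Real.pi * r * q t r)) r :=
    ((hp t ht).2.1 r hr).congr_of_eventuallyEq (heq.eventuallyEq_of_mem (Ioi_mem_nhds hr))
  refine ⟨hderiv.differentiableAt, ?_⟩
  rw [hderiv.deriv]
  field_simp
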